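/- Let $G=(V,E)$ be a simple, undirected, infinite, connected graph in which every vertex has finitely many neighbours, with a symmetric weight $\omega:V\times V\to[0,\infty)$ such that $\omega(x,y)>0$ if and only if $x\sim y$. Put $d_\omega(x)=\sum_{y\sim x}\omega(x,y)$, $\mu_\omega(U)=\sum_{x\in U}d_\omega(x)$, $\|f\|_{\ell^q(U)}^q=\sum_{x\in U}|f(x)|^q d_\omega(x)$, let $d$ be the combinatorial distance, and for $x_0\in V$, $R\in\mathbb N$ let $B_R=\{x: d(x,x_0)\le R\}$. Let $p>2$ and let $\Lambda:(0,\infty)\to(0,\infty)$ be continuous and decreasing, such that for some constants $N,\kappa>0$ the function $v\mapsto\Lambda(v)^{-1}v^{-p/N}$ is nondecreasing and $v\mapsto\Lambda(v)^{-1}v^{-\kappa}$ is nonincreasing on $(0,\infty)$. Assume the global Faber–Krahn inequality: for every $v>0$, every finite $U\subset V$ with $\mu_\omega(U)=v$ and every $f:V\to\mathbb R$ vanishing outside $U$, $$\Lambda(v)\sum_{x\in U}|f(x)|^p d_\omega(x)\le\sum_{x,y\in (U)_1}|f(y)-f(x)|^p\,\omega(x,y),\qquad (U)_1=\{x: d(x,U)\le1\}.$$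 Put $\psi_1(s)=s^{p-2}\Lambda(1/s)$ for $s>0$, a bijection of $(0,\infty)$ with inverse $\psi_1^{-1}$. Let $u_0\ge0$ be finitely supported and not identically zero, and let $u\ge0$ be a solution of $$\partial_t u(x,t)=\frac1{d_\omega(x)}\sum_{y\in V}|u(y,t)-u(x,t)|^{p-2}(u(y,t)-u(x,t))\,\omega(x,y),\quad x\in V,\ 0<t<T,\qquad u(\cdot,0)=u_0,$$ that is, for some $r\ge1$, $u\in L^\infty(0,T;\ell^r(V))$, $u(x,\cdot)\in C^1([0,T])$ for every $x\in V$, and the equation holds pointwise. (A solution for all times $t>0$ is covered by taking $T$ arbitrary.) Then for every $\varepsilon\in(0,1)$ there is $\Gamma=\Gamma(\varepsilon)>0$, depending only on $\varepsilon,p,N,\kappa$, such that for every $x_0\in V$, $0<t<T$ and $R\in\mathbb N$ for which $B_{\lfloor R/2\rfloor}$ contains the support of $u_0$ and $$R\ \ge\ \Gamma\, t^{1/p}\,\|u_0\|_{\ell^1(V)}^{(p-2)/p}\,\Big[\psi_1^{-1}\big(t^{-1}\|u_0\|_{\ell^1(V)}^{-(p-2)}\big)\Big]^{(p-2)/p}\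 \ge\ 8 ,\qquad(*)$$ one has $$\|u(t)\|_{\ell^1(B_R)}\ge(1-\varepsilon)\|u_0\|_{\ell^1(V)} .$$ Moreover, there is $\gamma>0$ depending only on $p,N,\kappa$ such that, if $B_{\lfloor R/2\rfloor}$ contains the support of $u_0$ and $(*)$ holds with $\Gamma=\Gamma(1/2)$, then for every $\alpha\in(0,1)$ $$\sum_{x\in V}d(x,x_0)^\alpha\,u(x,t)\,d_\omega(x)\le\gamma R^\alpha\|u_0\|_{\ell^1(V)},$$ the series being convergent. -/

import Mathlib

open Set MeasureTheory

/-- A weighted graph on the vertex set `V`: simple, undirected, connected and locally finite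
(every vertex has finitely many neighbours), with a symmetric weight `V × V → [0, ∞)` that is
strictly positive exactly on the edges. -/
structure WeightedGraph (V : Type*) where
  graph : SimpleGraph V
  connected : graph.Connected
  locallyFinite : ∀ x, (graph.neighborSet x).Finite
  weight : V → V → ℝ
  weight_nonneg : ∀ x y, 0 ≤ weight x y
  weight_symm : ∀ x y, weight x y = weight y x
  weight_pos_iff : ∀ x y, 0 < weight x y ↔ graph.Adj x y

noncomputable section

namespace WeightedGraph

variable {V : Type*} (W : WeightedGraph V)

/-- The finite set of neighbours of `x`. -/
def neighbors (x : V) : Finset V := (W.locallyFinite x).toFinset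

/-- The weighted degree of `x`, the sum of the weights of the edges at `x`. -/
def deg (x : V) : ℝ := ∑ y ∈ W.neighbors x, W.weight x y

/-- The closed ball of radius `R` around `x₀` for the combinatorial distance. -/
def ball (x₀ : V) (R : ℕ) : Set V := {x | W.graph.dist x x₀ ≤ R}

/-- The set of the vertices at distance at most one from `U`. -/
def nbhd (U : Set V) : Set V := {x | ∃ y ∈ U, W.graph.dist x y ≤ 1}

/-- Membership in `ℓ^q(V)`: the weighted sum of `|f|^q` converges. -/
def MemLq (q : ℝ) (f : V → ℝ) : Prop := Summable fun x => |f x| ^ q * W.deg x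

/-- The norm of `f` in `ℓ^q(U)`. -/
def lqNorm (q : ℝ) (U : Set V) (f : V → ℝ) : ℝ := (∑' x : U, |f x| ^ q * W.deg x) ^ (1 / q)

/-- The discrete `p`-Laplacian. The sum over all `y` reduces to the neighbours of `x`, because
the weight vanishes elsewhere. -/
def pLaplacian (p : ℝ) (f : V → ℝ) (x : V) : ℝ :=
  (W.deg x)⁻¹ * ∑ y ∈ W.neighbors x, |f y - f x| ^ (p - 2) * (f y - f x) * W.weight x y

/-- The global Faber-Krahn inequality with exponent `p` and function `Λ`. The sum on the right
runs over ordered pairs. -/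
def FaberKrahn (p : ℝ) (Λ : ℝ → ℝ) : Prop :=
  ∀ v : ℝ, 0 < v → ∀ U : Finset V, ∑ x ∈ U, W.deg x = v →
    ∀ f : V → ℝ, (∀ x, x ∉ U → f x = 0) →
      Λ v * ∑ x ∈ U, |f x| ^ p * W.deg x ≤
        ∑' x : W.nbhd (U : Set V), ∑' y : W.nbhd (U : Set V),
          |f (y : V) - f (x : V)| ^ p * W.weight (x : V) (y : V)

/-- `u` (with `u t x` the value at time `t` and vertex `x`) is a solution, in the class
`L^∞(0, T; ℓ^r(V))`, of the Cauchy problem `∂u/∂t = Δ_p u`, `u(·, 0) = u₀`. -/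
structure IsSolution (p r T : ℝ) (u₀ : V → ℝ) (u : ℝ → V → ℝ) : Prop where
  bounded : ∃ C : ℝ, ∀ᵐ t ∂(volume.restrict (Ioo 0 T)),
    W.MemLq r (u t) ∧ W.lqNorm r univ (u t) ≤ C
  contDiffOn : ∀ x, ContDiffOn ℝ 1 (fun t => u t x) (Icc 0 T)
  equation : ∀ x, ∀ t ∈ Ioo 0 T, HasDerivAt (fun s => u s x) (W.pLaplacian p (u t) x) t
  initial : ∀ x, u 0 x = u₀ x

end WeightedGraph

/-- The assumptions on a Faber-Krahn function `Λ : (0, ∞) → (0, ∞)`; only its values on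
`(0, ∞)` matter. -/
structure IsFaberKrahnFunction (p N κ : ℝ) (Λ : ℝ → ℝ) : Prop where
  pos : ∀ v, 0 < v → 0 < Λ v
  continuousOn : ContinuousOn Λ (Ioi 0)
  antitoneOn : AntitoneOn Λ (Ioi 0)
  monotoneOn_mul : MonotoneOn (fun v => (Λ v)⁻¹ * v ^ (-(p / N))) (Ioi 0)
  antitoneOn_mul : AntitoneOn (fun v => (Λ v)⁻¹ * v ^ (-κ)) (Ioi 0)

/-- The function `ψ_r(s) = s^((p-2)/r) Λ(1/s)`. -/
def psi (p r : ℝ) (Λ : ℝ → ℝ) (s : ℝ) : ℝ := s ^ ((p - 2) / r) * Λ s⁻¹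

/-- The inverse of the bijection `ψ_r` of `(0, ∞)` onto itself. -/
def psiInv (p r : ℝ) (Λ : ℝ → ℝ) : ℝ → ℝ := Function.invFunOn (psi p r Λ) (Ioi 0)

/-- The critical radius for the spread of the mass `M` up to time `t`, without its constant:
`t^(1/p) M^((p-2)/p) [ψ₁⁻¹(t⁻¹ M^(-(p-2)))]^((p-2)/p)`. -/
def criticalRadius (p : ℝ) (Λ : ℝ → ℝ) (M t : ℝ) : ℝ :=
  t ^ (1 / p) * M ^ ((p - 2) / p) * psiInv p 1 Λ (t⁻¹ * M ^ (-(p - 2))) ^ ((p - 2) / p)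

end

/-!
The argument needs no decay estimate for the supremum of `u`: one weighted sum of powers of `u`
suffices, together with comparison functions in time.

Put `θ = (p - 2) / (p - 1)`, `M` for the mass, and `Y t` for the sum of `u ^ (1 + θ)` with respect
to the degrees. A solution loses `Y` at the rate given by the dissipation
`∑ |D u|^(p-1) |D u^θ|` over the edges. Two inequalities connect this dissipation with the rest.

* Nash (`nash_inequality`): the Faber-Krahn inequality, applied to the truncation
  `(u ^ σ - k ^ σ)₊` with `σ = (p + θ - 1) / p`, bounds `Y` by `(2 k) ^ θ M` plus a multiple of the
  dissipation. Choosing `k` so that the first term is half of `Y` gives a differential inequality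
  for `Y`, which yields the decay `Y s ≤ C M (M P) ^ θ (t / s) ^ (θ / a)` for `s ≤ t`, with
  `P = ψ₁⁻¹(t⁻¹ M^(-(p-2)))` and `a = p - 2 + p / N` (`IsDominated.tsum_rpow_le`).
* Flow (`abs_sub_rpow_le_dissipation`, `IsDominated.tsum_abs_flow_le`): for every `λ > 0` the total
  flow `∑ |D u|^(p-1)` is at most a multiple of `λ` times the dissipation plus
  `2 λ^(-(p-1)) M`.

Let `φ` be bounded, with increments at most `L` along the edges. The sum of `u φ` changes at a rate
at most `L / 2` times the total flow. With `λ` proportional to `s ^ β`,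
`θ / a < β < 1 / (p - 1)`, an explicit comparison function shows that in time `t` this sum changes
by at most `L C M` times the critical radius (`le_add_of_flux_le`, `IsDominated.tsum_mul_le_add`).
A cutoff function of the ball gives the lower bound for the mass, and truncations of
`(R + d) ^ α`, whose increments are at most `R ^ (α - 1)`, give the moments.

All series are handled through one majorant. The Faber-Krahn inequality on single vertices bounds
the degrees from below, so that `u` is bounded; then `exp (c t) u` is nondecreasing in `t` for some
`c`, and the final value, up to a factor, dominates `u` at all times. Its `ℓ^r` summability improves
to `ℓ^1` because the operator raises `u` to the power `p - 1 > 1` and the initial datum has finite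
support (`IsSolution.exists_isDominated`).
-/

/-! ### Sums over vertices and edges -/

namespace WeightedGraph

variable {V : Type*} (W : WeightedGraph V)

lemma weight_eq_zero_of_notMem {x y : V} (h : y ∉ W.neighbors x) : W.weight x y = 0 := by
  have h' : ¬ W.graph.Adj x y := by simpa [neighbors] using h
  rw [← W.weight_pos_iff] at h'
  exact le_antisymm (not_lt.mp h') (W.weight_nonneg x y)

lemma weight_eq_zero_of_not_adj {x y : V} (h : ¬ W.graph.Adj x y) : W.weight x y = 0 :=
  W.weight_eq_zero_of_notMem (by simpa [neighbors] using h)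

lemma hasSum_mul_weight (f : V → ℝ) (x : V) :
    HasSum (fun y => f y * W.weight x y) (∑ y ∈ W.neighbors x, f y * W.weight x y) :=
  hasSum_sum_of_ne_finset_zero fun y hy => by simp [W.weight_eq_zero_of_notMem hy]

lemma hasSum_weight (x : V) : HasSum (W.weight x) (W.deg x) := by
  simpa [deg] using W.hasSum_mul_weight (fun _ => 1) x

lemma deg_nonneg (x : V) : 0 ≤ W.deg x := Finset.sum_nonneg fun _ _ => W.weight_nonneg _ _

lemma deg_pos [Infinite V] (x : V) : 0 < W.deg x := by
  obtain ⟨y, hy⟩ := W.connected.preconnected.exists_adj_of_nontrivial x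
  exact Finset.sum_pos' (fun _ _ => W.weight_nonneg _ _)
    ⟨y, by simpa [neighbors] using hy, (W.weight_pos_iff x y).2 hy⟩

section EdgeSums

variable {h : V → ℝ}

lemma summable_edge_fst (h0 : ∀ x, 0 ≤ h x) (hs : Summable fun x => h x * W.deg x) :
    Summable fun z : V × V => h z.1 * W.weight z.1 z.2 := by
  refine (summable_prod_of_nonneg fun z => mul_nonneg (h0 _) (W.weight_nonneg _ _)).2
    ⟨fun x => (W.hasSum_weight x).summable.mul_left (h x), hs.congr fun x => ?_⟩
  exact ((W.hasSum_weight x).mul_left (h x)).tsum_eq.symm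

lemma summable_edge_snd (h0 : ∀ x, 0 ≤ h x) (hs : Summable fun x => h x * W.deg x) :
    Summable fun z : V × V => h z.2 * W.weight z.1 z.2 := by
  refine (W.summable_edge_fst h0 hs).prod_symm.congr fun z => ?_
  rw [Prod.fst_swap, Prod.snd_swap, W.weight_symm z.1]

lemma tsum_edge_fst (h0 : ∀ x, 0 ≤ h x) (hs : Summable fun x => h x * W.deg x) :
    ∑' z : V × V, h z.1 * W.weight z.1 z.2 = ∑' x, h x * W.deg x := by
  rw [(W.summable_edge_fst h0 hs).tsum_prod]
  simp only [tsum_mul_left, (W.hasSum_weight _).tsum_eq]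

lemma tsum_edge_snd (h0 : ∀ x, 0 ≤ h x) (hs : Summable fun x => h x * W.deg x) :
    ∑' z : V × V, h z.2 * W.weight z.1 z.2 = ∑' x, h x * W.deg x := by
  rw [← W.tsum_edge_fst h0 hs, ← (Equiv.prodComm V V).tsum_eq]
  refine tsum_congr fun z => ?_
  rw [Equiv.prodComm_apply, Prod.fst_swap, Prod.snd_swap, W.weight_symm z.1]

lemma summable_edge_add (h0 : ∀ x, 0 ≤ h x) (hs : Summable fun x => h x * W.deg x) :
    Summable fun z : V × V => (h z.1 + h z.2) * W.weight z.1 z.2 := by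
  simpa only [add_mul] using (W.summable_edge_fst h0 hs).add (W.summable_edge_snd h0 hs)

lemma tsum_edge_add (h0 : ∀ x, 0 ≤ h x) (hs : Summable fun x => h x * W.deg x) :
    ∑' z : V × V, (h z.1 + h z.2) * W.weight z.1 z.2 = 2 * ∑' x, h x * W.deg x := by
  simp only [add_mul]
  rw [(W.summable_edge_fst h0 hs).tsum_add (W.summable_edge_snd h0 hs), W.tsum_edge_fst h0 hs,
    W.tsum_edge_snd h0 hs]
  ring

end EdgeSums

end WeightedGraph

/-- Discrete integration by parts: pairing a bounded function of the first endpoint with a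
summable antisymmetric function of the edge. -/
lemma tsum_mul_antisymm {V : Type*} {J : V × V → ℝ} (hJ : Summable J)
    (hanti : ∀ z, J z.swap = -J z) {H : V → ℝ} {B : ℝ} (hH : ∀ x, |H x| ≤ B) :
    ∑' x, H x * ∑' y, J (x, y) = -(1 / 2) * ∑' z : V × V, (H z.2 - H z.1) * J z := by
  have h1 : Summable fun z : V × V => H z.1 * J z :=
    (hJ.norm.mul_left B).of_norm_bounded fun z => by
      rw [norm_mul]; gcongr; exact hH _
  have h2 : Summable fun z : V × V => H z.2 * J z :=
    (hJ.norm.mul_left B).of_norm_bounded fun z => by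
      rw [norm_mul]; gcongr; exact hH _
  have h3 : ∑' z : V × V, H z.2 * J z = -∑' z : V × V, H z.1 * J z := by
    rw [← (Equiv.prodComm V V).tsum_eq, ← tsum_neg]
    exact tsum_congr fun z => by simp [hanti]
  have h4 : ∑' x, H x * ∑' y, J (x, y) = ∑' z : V × V, H z.1 * J z := by
    rw [h1.tsum_prod]
    simp only [tsum_mul_left]
  simp only [sub_mul]
  rw [h2.tsum_sub h1, h3, h4]
  ring

lemma tsum_subtype_prod_le {V : Type*} {F : V × V → ℝ} (hF : Summable F) (h0 : ∀ z, 0 ≤ F z)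
    (s : Set V) : ∑' x : s, ∑' y : s, F (x, y) ≤ ∑' z, F z := by
  have hinj : Function.Injective (Prod.map ((↑) : s → V) ((↑) : s → V)) :=
    Subtype.val_injective.prodMap Subtype.val_injective
  have h1 : Summable fun z : s × s => F (z.1, z.2) := hF.comp_injective hinj
  rw [← h1.tsum_prod]
  exact tsum_comp_le_tsum_of_inj hF h0 hinj

namespace WeightedGraph

variable {V : Type*} (W : WeightedGraph V)

/-- The Faber-Krahn inequality tested with the indicator of one vertex bounds `Λ` from above at
every degree; since `Λ` blows up at zero, the degrees are bounded away from zero. -/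
lemma exists_deg_lower_bound [Infinite V] {p N κ : ℝ} {Λ : ℝ → ℝ} (hp : 0 < p) (hN : 0 < N)
    (hΛ : IsFaberKrahnFunction p N κ Λ) (hFK : W.FaberKrahn p Λ) :
    ∃ c, 0 < c ∧ ∀ x, c ≤ W.deg x := by
  classical
  have hpN : 0 < p / N := div_pos hp hN
  have hΛ1 := hΛ.pos 1 one_pos
  have key : ∀ x, Λ (W.deg x) ≤ 2 := by
    intro x
    have hd := W.deg_pos x
    set f : V → ℝ := fun y => if y = x then 1 else 0 with hf
    have f0 : ∀ y, 0 ≤ f y := fun y => by simp only [hf]; split_ifs <;> norm_num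
    have hs : HasSum (fun y => f y * W.deg y) (W.deg x) := by
      convert hasSum_ite_eq x (W.deg x) using 2 with y
      by_cases hy : y = x <;> simp [hf, hy]
    have hpt : ∀ z : V × V, |f z.2 - f z.1| ^ p * W.weight z.1 z.2 ≤
        (f z.1 + f z.2) * W.weight z.1 z.2 := by
      intro z
      refine mul_le_mul_of_nonneg_right ?_ (W.weight_nonneg _ _)
      by_cases h1 : z.1 = x <;> by_cases h2 : z.2 = x <;> simp [hf, h1, h2, hp.ne']
    have hsum := W.summable_edge_add f0 hs.summable
    have hsum' : Summable fun z : V × V => |f z.2 - f z.1| ^ p * W.weight z.1 z.2 :=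
      hsum.of_nonneg_of_le (fun z => mul_nonneg (by positivity) (W.weight_nonneg _ _)) hpt
    have h1 := hFK (W.deg x) hd {x} (by simp) f (fun y hy => by
      simp only [Finset.mem_singleton] at hy; simp [hf, hy])
    have h2 := tsum_subtype_prod_le hsum'
      (fun z => mul_nonneg (by positivity) (W.weight_nonneg _ _)) (W.nbhd (({x} : Finset V) : Set V))
    have h3 := hsum'.tsum_le_tsum hpt hsum
    rw [W.tsum_edge_add f0 hs.summable, hs.tsum_eq] at h3
    have h4 := h1.trans (h2.trans h3)
    simp only [Finset.sum_singleton, hf, if_true, abs_one, Real.one_rpow, one_mul] at h4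
    exact le_of_mul_le_mul_right h4 hd
  refine ⟨min 1 ((Λ 1 / 2) ^ (N / p)), lt_min one_pos (by positivity), fun x => ?_⟩
  rcases le_total 1 (W.deg x) with h | h
  · exact (min_le_left _ _).trans h
  refine (min_le_right _ _).trans ?_
  have hd := W.deg_pos x
  have hm := hΛ.monotoneOn_mul (mem_Ioi.2 hd) (mem_Ioi.2 one_pos) h
  simp only [Real.one_rpow, mul_one] at hm
  have hΛd := hΛ.pos _ hd
  rw [Real.rpow_neg hd.le, ← mul_inv, inv_le_inv₀ (by positivity) hΛ1] at hm
  have h5 : Λ 1 / 2 ≤ W.deg x ^ (p / N) := by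
    have := mul_le_mul_of_nonneg_right (key x) (Real.rpow_nonneg hd.le (p / N))
    linarith
  calc (Λ 1 / 2) ^ (N / p) ≤ (W.deg x ^ (p / N)) ^ (N / p) := by gcongr
    _ = W.deg x := by
      rw [← Real.rpow_mul hd.le, div_mul_div_cancel₀ hN.ne', div_self hp.ne', Real.rpow_one]

/-- The flow `|D f|^(p-2) D f` along the edge from `x` to `y`, times the weight of that edge. -/
noncomputable def flow (p : ℝ) (f : V → ℝ) (z : V × V) : ℝ :=
  |f z.2 - f z.1| ^ (p - 2) * (f z.2 - f z.1) * W.weight z.1 z.2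

lemma flow_swap (p : ℝ) (f : V → ℝ) (z : V × V) : W.flow p f z.swap = -W.flow p f z := by
  simp only [flow, Prod.fst_swap, Prod.snd_swap, W.weight_symm z.2 z.1, abs_sub_comm (f z.1)]
  ring

lemma pLaplacian_mul_deg [Infinite V] (p : ℝ) (f : V → ℝ) (x : V) :
    W.pLaplacian p f x * W.deg x = ∑' y, W.flow p f (x, y) := by
  rw [pLaplacian, mul_comm, mul_inv_cancel_left₀ (W.deg_pos x).ne']
  exact (W.hasSum_mul_weight (fun y => |f y - f x| ^ (p - 2) * (f y - f x)) x).tsum_eq.symm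

lemma abs_flow {p : ℝ} (hp : 2 < p) (f : V → ℝ) (z : V × V) :
    |W.flow p f z| = |f z.2 - f z.1| ^ (p - 1) * W.weight z.1 z.2 := by
  rw [flow, abs_mul, abs_mul, abs_of_nonneg (W.weight_nonneg _ _),
    abs_of_nonneg (Real.rpow_nonneg (abs_nonneg _) _),
    ← Real.rpow_add_one' (abs_nonneg _) (by linarith)]
  ring_nf

lemma abs_flow_le {p K : ℝ} (hp : 2 < p) {f g : V → ℝ} (f0 : ∀ x, 0 ≤ f x) (hfg : ∀ x, f x ≤ g x)
    (hK : ∀ x, g x ≤ K) (z : V × V) :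
    |W.flow p f z| ≤ K ^ (p - 2) * ((g z.1 + g z.2) * W.weight z.1 z.2) := by
  have hd : |f z.2 - f z.1| ≤ g z.1 + g z.2 := by
    rw [abs_le]; constructor <;> linarith [f0 z.1, f0 z.2, hfg z.1, hfg z.2]
  have hd' : |f z.2 - f z.1| ≤ K := by
    rw [abs_le]; constructor <;>
      linarith [f0 z.1, f0 z.2, hfg z.1, hfg z.2, hK z.1, hK z.2]
  rw [flow, abs_mul, abs_mul, abs_of_nonneg (W.weight_nonneg _ _),
    abs_of_nonneg (Real.rpow_nonneg (abs_nonneg _) _), mul_assoc]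
  have := W.weight_nonneg z.1 z.2
  have : 0 ≤ K := (abs_nonneg _).trans hd'
  gcongr

end WeightedGraph

/-! ### Pointwise inequalities -/

/-- For the concave power `s ↦ s ^ θ`, the increment from `a` to `b` dominates the one given by
the slope at the larger endpoint. -/
lemma mul_rpow_sub_one_mul_le {a b θ : ℝ} (ha : 0 ≤ a) (hb : 0 < b) (hθ : 0 < θ)
    (hθ1 : θ ≤ 1) : θ * b ^ (θ - 1) * (b - a) ≤ b ^ θ - a ^ θ := by
  have h1 := rpow_one_add_le_one_add_mul_self (s := a / b - 1)
    (by have := div_nonneg ha hb.le; linarith) hθ.le hθ1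
  rw [add_sub_cancel, Real.div_rpow ha hb.le, div_le_iff₀ (by positivity)] at h1
  rw [Real.rpow_sub_one hb.ne']
  have h2 : (1 + θ * (a / b - 1)) * b ^ θ = b ^ θ - θ * (b ^ θ / b) * (b - a) := by
    field_simp; ring
  linarith

lemma rpow_sub_rpow_le {a b σ : ℝ} (ha : 0 ≤ a) (hab : a ≤ b) (hb : 0 < b) (hσ1 : σ ≤ 1) :
    b ^ σ - a ^ σ ≤ b ^ (σ - 1) * (b - a) := by
  have h0 : 0 ≤ a / b := div_nonneg ha hb.le
  have h1 : a / b ≤ (a / b) ^ σ := by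
    rcases h0.eq_or_lt with h | h
    · rw [← h]; exact Real.rpow_nonneg le_rfl _
    · simpa using Real.rpow_le_rpow_of_exponent_ge h ((div_le_one hb).2 hab) hσ1
  rw [Real.div_rpow ha hb.le, le_div_iff₀ (by positivity)] at h1
  rw [Real.rpow_sub_one hb.ne']
  have h2 : b ^ σ / b * (b - a) = b ^ σ - a / b * b ^ σ := by field_simp
  linarith

/-- The dissipation density controls the `p`-energy of the power `u ^ σ`,
`σ = (p + θ - 1) / p`. -/
lemma abs_rpow_sub_rpow_rpow_le {a b p θ : ℝ} (ha : 0 ≤ a) (hb : 0 ≤ b) (hp : 1 < p) (hθ : 0 < θ)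
    (hθ1 : θ ≤ 1) :
    |b ^ ((p + θ - 1) / p) - a ^ ((p + θ - 1) / p)| ^ p ≤
      θ⁻¹ * (|b - a| ^ (p - 1) * |b ^ θ - a ^ θ|) := by
  have hp0 : 0 < p := by linarith
  have hσ0 : 0 < (p + θ - 1) / p := by apply div_pos <;> linarith
  wlog hab : a ≤ b generalizing a b
  · have h := this hb ha (le_of_not_ge hab)
    rwa [abs_sub_comm (a ^ ((p + θ - 1) / p)), abs_sub_comm (a ^ θ), abs_sub_comm a] at h
  rcases hb.eq_or_lt with rfl | hb'
  · obtain rfl : a = 0 := le_antisymm hab ha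
    simp [hp0.ne']
  have hσ : (p + θ - 1) / p ≤ 1 := by rw [div_le_one hp0]; linarith
  have hmono : ∀ q : ℝ, 0 < q → a ^ q ≤ b ^ q := fun q hq => Real.rpow_le_rpow ha hab hq.le
  have h0 : 0 ≤ b - a := sub_nonneg.2 hab
  rw [abs_of_nonneg (sub_nonneg.2 (hmono _ hσ0)), abs_of_nonneg h0,
    abs_of_nonneg (sub_nonneg.2 (hmono _ hθ))]
  calc (b ^ ((p + θ - 1) / p) - a ^ ((p + θ - 1) / p)) ^ p
      ≤ (b ^ ((p + θ - 1) / p - 1) * (b - a)) ^ p :=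
        Real.rpow_le_rpow (sub_nonneg.2 (hmono _ hσ0)) (rpow_sub_rpow_le ha hab hb' hσ) hp0.le
    _ = b ^ (θ - 1) * (b - a) ^ p := by
        rw [Real.mul_rpow (by positivity) h0, ← Real.rpow_mul hb]
        congr 2; field_simp; ring
    _ = θ⁻¹ * ((b - a) ^ (p - 1) * (θ * b ^ (θ - 1) * (b - a))) := by
        have : (b - a) ^ p = (b - a) ^ (p - 1) * (b - a) := by
          rw [← Real.rpow_add_one' h0 (by linarith)]; ring_nf
        rw [this]; field_simp
    _ ≤ _ := by
        gcongr
        exact mul_rpow_sub_one_mul_le ha hb' hθ hθ1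

/-- The flow along an edge is controlled by the dissipation density with `θ = (p - 2) / (p - 1)`
and by the mass: this value of `θ` makes the remaining power of `u` equal to one. -/
lemma abs_sub_rpow_le_dissipation {a b p lam : ℝ} (ha : 0 ≤ a) (hb : 0 ≤ b) (hp : 2 < p)
    (hlam : 0 < lam) :
    |b - a| ^ (p - 1) ≤
      lam * ((p - 2) / (p - 1))⁻¹ *
        (|b - a| ^ (p - 1) * |b ^ ((p - 2) / (p - 1)) - a ^ ((p - 2) / (p - 1))|) +
      lam ^ (-(p - 1)) * (a + b) := by
  have hp1 : 0 < p - 1 := by linarith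
  wlog hab : a ≤ b generalizing a b
  · have h := this hb ha (le_of_not_ge hab)
    rwa [abs_sub_comm (a ^ ((p - 2) / (p - 1))), abs_sub_comm a, add_comm b] at h
  set θ := (p - 2) / (p - 1) with hθdef
  have hθ : 0 < θ := div_pos (by linarith) hp1
  have hθ1 : θ ≤ 1 := by rw [hθdef, div_le_one hp1]; linarith
  rcases hab.eq_or_lt with rfl | hlt
  · simp only [sub_self, abs_zero, mul_zero, zero_add]
    rw [Real.zero_rpow hp1.ne']; positivity
  have hb' : 0 < b := ha.trans_lt hlt
  have hD : 0 < b - a := sub_pos.2 hlt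
  have hinc := mul_rpow_sub_one_mul_le ha hb' hθ hθ1
  rw [abs_of_pos hD, abs_of_nonneg (le_trans (by positivity) hinc)]
  rcases le_total 1 (lam * (b - a) * b ^ (θ - 1)) with h | h
  · have : (b - a) ^ (p - 1) ≤ lam * θ⁻¹ * ((b - a) ^ (p - 1) * (b ^ θ - a ^ θ)) := by
      calc (b - a) ^ (p - 1) ≤ (b - a) ^ (p - 1) * (lam * (b - a) * b ^ (θ - 1)) :=
            le_mul_of_one_le_right (by positivity) h
        _ = lam * θ⁻¹ * ((b - a) ^ (p - 1) * (θ * b ^ (θ - 1) * (b - a))) := by field_simp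
        _ ≤ _ := by gcongr
    have h2 : 0 ≤ lam ^ (-(p - 1)) * (a + b) := by positivity
    linarith
  · have hexp : (θ - 1) * (p - 1) = -1 := by rw [hθdef]; field_simp; ring
    have h1 : (lam * (b - a) * b ^ (θ - 1)) ^ (p - 1) ≤ 1 :=
      Real.rpow_le_one (by positivity) h hp1.le
    rw [Real.mul_rpow (by positivity) (by positivity), Real.mul_rpow hlam.le hD.le,
      ← Real.rpow_mul hb, hexp, Real.rpow_neg_one, ← div_eq_mul_inv, div_le_one hb'] at h1
    have h3 : (b - a) ^ (p - 1) ≤ lam ^ (-(p - 1)) * (a + b) := by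
      rw [Real.rpow_neg hlam.le, inv_mul_eq_div, le_div_iff₀ (by positivity), mul_comm]
      linarith
    have h4 : 0 ≤ lam * θ⁻¹ * ((b - a) ^ (p - 1) * (b ^ θ - a ^ θ)) := by
      have := le_trans (by positivity) hinc
      positivity
    linarith

/-! ### The function `psi` and its inverse -/

section Psi

variable {p N κ : ℝ} {Λ : ℝ → ℝ}

lemma psi_one_eq (s : ℝ) : psi p 1 Λ s = s ^ (p - 2) * Λ s⁻¹ := by simp [psi]

lemma psi_one_pos (hΛ : IsFaberKrahnFunction p N κ Λ) {s : ℝ} (hs : 0 < s) : 0 < psi p 1 Λ s := by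
  have := hΛ.pos s⁻¹ (by positivity)
  rw [psi_one_eq]; positivity

/-- `psi p 1 Λ` grows at least like the power `p - 2 + p / N`. -/
lemma psi_div_rpow_mono (hΛ : IsFaberKrahnFunction p N κ Λ) {s t : ℝ} (hs : 0 < s) (hst : s ≤ t) :
    psi p 1 Λ s / s ^ (p - 2 + p / N) ≤ psi p 1 Λ t / t ^ (p - 2 + p / N) := by
  have ht : 0 < t := hs.trans_le hst
  have key : ∀ r : ℝ, 0 < r → psi p 1 Λ r / r ^ (p - 2 + p / N) =
      ((Λ r⁻¹)⁻¹ * r⁻¹ ^ (-(p / N)))⁻¹ := by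
    intro r hr
    rw [psi_one_eq, Real.rpow_add hr, mul_inv, inv_inv, Real.inv_rpow hr.le, inv_inv,
      Real.rpow_neg hr.le]
    field_simp
  have hm := hΛ.monotoneOn_mul (mem_Ioi.2 (inv_pos.2 ht)) (mem_Ioi.2 (inv_pos.2 hs))
    (inv_anti₀ hs hst)
  have h1 := hΛ.pos t⁻¹ (by positivity)
  rw [key s hs, key t ht]
  exact inv_anti₀ (by positivity) hm

/-- `psiInv p 1 Λ` is a right inverse of `psi p 1 Λ` on `(0, ∞)`, by the intermediate value
theorem. -/
lemma psiInv_spec (hp : 2 < p) (hN : 0 < N) (hΛ : IsFaberKrahnFunction p N κ Λ) {z : ℝ}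
    (hz : 0 < z) : 0 < psiInv p 1 Λ z ∧ psi p 1 Λ (psiInv p 1 Λ z) = z := by
  set a := p - 2 + p / N with hadef
  have ha : 0 < a := by have : 0 < p / N := by positivity
                        linarith
  have hc : 0 < psi p 1 Λ 1 := psi_one_pos hΛ one_pos
  have hcont : ContinuousOn (psi p 1 Λ) (Ioi 0) := by
    have : ContinuousOn (fun s : ℝ => s ^ ((p - 2) / 1) * Λ s⁻¹) (Ioi 0) := by
      refine ContinuousOn.mul (fun s hs => ?_) (hΛ.continuousOn.comp ?_ ?_)
      · exact (Real.continuousAt_rpow_const _ _ (Or.inl (mem_Ioi.1 hs).ne')).continuousWithinAt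
      · exact continuousOn_inv₀.mono fun s hs => (mem_Ioi.1 hs).ne'
      · intro s hs; exact mem_Ioi.2 (inv_pos.2 hs)
    exact this
  set q := z / psi p 1 Λ 1 with hq
  have hq0 : 0 < q := by positivity
  have hpow : ∀ r : ℝ, 0 < r → (r ^ (1 / a)) ^ a = r := fun r hr => by
    rw [← Real.rpow_mul hr.le, one_div_mul_cancel ha.ne', Real.rpow_one]
  obtain ⟨s, hs0, hs⟩ : ∃ s, 0 < s ∧ psi p 1 Λ s ≤ z := by
    have h01 : 0 < min 1 q := lt_min one_pos hq0
    refine ⟨(min 1 q) ^ (1 / a), by positivity, ?_⟩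
    have h := psi_div_rpow_mono hΛ (s := (min 1 q) ^ (1 / a)) (t := 1) (by positivity)
      (Real.rpow_le_one h01.le (min_le_left _ _) (by positivity))
    rw [← hadef, hpow _ h01, Real.one_rpow, div_one, div_le_iff₀ h01] at h
    calc _ ≤ psi p 1 Λ 1 * min 1 q := h
      _ ≤ psi p 1 Λ 1 * q := by gcongr; exact min_le_right _ _
      _ = z := by rw [hq]; field_simp
  obtain ⟨t, ht0, ht⟩ : ∃ t, 0 < t ∧ z ≤ psi p 1 Λ t := by
    have h01 : 0 < max 1 q := lt_max_of_lt_left one_pos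
    refine ⟨(max 1 q) ^ (1 / a), by positivity, ?_⟩
    have h := psi_div_rpow_mono hΛ (s := 1) (t := (max 1 q) ^ (1 / a)) one_pos
      (Real.one_le_rpow (le_max_left _ _) (by positivity))
    rw [← hadef, hpow _ h01, Real.one_rpow, div_one, le_div_iff₀ h01] at h
    calc z = psi p 1 Λ 1 * q := by rw [hq]; field_simp
      _ ≤ psi p 1 Λ 1 * max 1 q := by gcongr; exact le_max_right _ _
      _ ≤ _ := h
  have hex : ∃ r ∈ Ioi (0 : ℝ), psi p 1 Λ r = z := by
    have := isPreconnected_Ioi.intermediate_value (mem_Ioi.2 hs0) (mem_Ioi.2 ht0) hcont ⟨hs, ht⟩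
    simpa using this
  exact ⟨Function.invFunOn_mem hex, Function.invFunOn_eq hex⟩

/-- If `psi w` exceeds `psi P` at most by a factor `c ≥ 1`, then `w` exceeds `P` at most by the
factor `c ^ (1 / a)`, `a = p - 2 + p / N`. -/
lemma le_mul_of_psi_le (hp : 2 < p) (hN : 0 < N) (hΛ : IsFaberKrahnFunction p N κ Λ) {w P c : ℝ}
    (hw : 0 < w) (hP : 0 < P) (hc : 1 ≤ c) (h : psi p 1 Λ w ≤ c * psi p 1 Λ P) :
    w ≤ P * c ^ (1 / (p - 2 + p / N)) := by
  have ha : 0 < p - 2 + p / N := by have : 0 < p / N := by positivity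
                                    linarith
  rcases le_total w P with hwP | hwP
  · exact hwP.trans (le_mul_of_one_le_right hP.le (Real.one_le_rpow hc (by positivity)))
  have h1 := psi_div_rpow_mono hΛ hP hwP
  have hψ := psi_one_pos hΛ hP
  rw [div_le_div_iff₀ (by positivity) (by positivity)] at h1
  have h2 : w ^ (p - 2 + p / N) ≤ c * P ^ (p - 2 + p / N) := by
    refine le_of_mul_le_mul_left ?_ hψ
    calc _ ≤ psi p 1 Λ w * P ^ (p - 2 + p / N) := h1
      _ ≤ c * psi p 1 Λ P * P ^ (p - 2 + p / N) := by gcongr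
      _ = _ := by ring
  have h3 := Real.rpow_le_rpow (by positivity) h2 (z := 1 / (p - 2 + p / N)) (by positivity)
  rw [← Real.rpow_mul hw.le, mul_one_div_cancel ha.ne', Real.rpow_one,
    Real.mul_rpow (by positivity) (by positivity), ← Real.rpow_mul hP.le,
    mul_one_div_cancel ha.ne', Real.rpow_one] at h3
  linarith

end Psi

/-! ### Regularity of bounded solutions -/

lemma antitoneOn_Icc_of_hasDerivAt_nonpos {f f' : ℝ → ℝ} {a b : ℝ} (hc : ContinuousOn f (Icc a b))
    (hd : ∀ t ∈ Ioo a b, HasDerivAt f (f' t) t) (hn : ∀ t ∈ Ioo a b, f' t ≤ 0) :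
    AntitoneOn f (Icc a b) := by
  refine antitoneOn_of_deriv_nonpos (convex_Icc a b) hc ?_ ?_ <;> rw [interior_Icc]
  · exact fun t ht => (hd t ht).differentiableAt.differentiableWithinAt
  · exact fun t ht => (hd t ht).deriv.trans_le (hn t ht)

/-- A bound that a continuous function satisfies almost everywhere on an interval holds
everywhere on the closed interval. -/
lemma le_on_Icc_of_ae_le {f : ℝ → ℝ} {T C : ℝ} (hT : 0 < T) (hc : ContinuousOn f (Icc 0 T))
    (h : ∀ᵐ t ∂(volume.restrict (Ioo 0 T)), f t ≤ C) : ∀ t ∈ Icc 0 T, f t ≤ C := by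
  rw [Measure.restrict_congr_set Ioo_ae_eq_Icc] at h
  have h1 : EqOn (fun t => max (f t) C) (fun _ => C) (Icc 0 T) :=
    Measure.eqOn_Icc_of_ae_eq volume hT.ne (h.mono fun t ht => max_eq_right ht)
      (hc.sup continuousOn_const) continuousOn_const
  exact fun t ht => max_eq_right_iff.1 (h1 ht)

namespace WeightedGraph

variable {V : Type*} {W : WeightedGraph V}

/-- A nonnegative classical solution on `[0, T]` that is dominated, uniformly in time, by a
bounded function `g` of finite mass. The majorant makes all the series of the proof converge
uniformly in time. -/
structure IsDominated (W : WeightedGraph V) (p T K : ℝ) (u : ℝ → V → ℝ) (g : V → ℝ) : Prop where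
  nonneg : ∀ t ∈ Icc 0 T, ∀ x, 0 ≤ u t x
  le_majorant : ∀ t ∈ Icc 0 T, ∀ x, u t x ≤ g x
  majorant_le : ∀ x, g x ≤ K
  summable : Summable fun x => g x * W.deg x
  continuousOn : ∀ x, ContinuousOn (fun t => u t x) (Icc 0 T)
  equation : ∀ x, ∀ t ∈ Ioo 0 T, HasDerivAt (fun s => u s x) (W.pLaplacian p (u t) x) t

/-- The `ℓ^r` bound and the lower bound on the degrees make a solution bounded. -/
lemma IsSolution.exists_bound {p r T c : ℝ} {u₀ : V → ℝ} {u : ℝ → V → ℝ}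
    (hsol : W.IsSolution p r T u₀ u) (hr : 1 ≤ r) (hT : 0 < T) (hc : 0 < c)
    (hdeg : ∀ x, c ≤ W.deg x) (hu : ∀ t ∈ Icc 0 T, ∀ x, 0 ≤ u t x) :
    (∃ K, 0 ≤ K ∧ ∀ t ∈ Icc 0 T, ∀ x, u t x ≤ K) ∧
      ∀ t ∈ Icc 0 T, Summable fun x => u t x ^ r * W.deg x := by
  have hr0 : 0 < r := by linarith
  obtain ⟨C, hC⟩ := hsol.bounded
  have hfin : ∀ F : Finset V, ∀ t ∈ Icc 0 T, ∑ x ∈ F, |u t x| ^ r * W.deg x ≤ C ^ r := by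
    intro F
    refine le_on_Icc_of_ae_le hT ?_ ?_
    · refine continuousOn_finsetSum _ fun x _ => ContinuousOn.mul ?_ continuousOn_const
      exact (hsol.contDiffOn x).continuousOn.abs.rpow_const fun _ _ => Or.inr hr0.le
    · refine hC.mono fun t ht => ?_
      have h0 : ∀ x, 0 ≤ |u t x| ^ r * W.deg x := fun x => by
        have := W.deg_nonneg x; positivity
      refine (ht.1.sum_le_tsum F fun x _ => h0 x).trans ?_
      have h2 := ht.2
      rw [lqNorm, tsum_univ fun x => |u t x| ^ r * W.deg x] at h2
      have h3 := Real.rpow_le_rpow (Real.rpow_nonneg (tsum_nonneg h0) _) h2 hr0.le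
      rwa [← Real.rpow_mul (tsum_nonneg h0), one_div_mul_cancel hr0.ne', Real.rpow_one] at h3
  refine ⟨⟨(|C| ^ r / c) ^ (1 / r), by positivity, fun t ht x => ?_⟩, fun t ht => ?_⟩
  · have h1 := hfin {x} t ht
    rw [Finset.sum_singleton, abs_of_nonneg (hu t ht x)] at h1
    have h0 := hu t ht x
    have h2 : u t x ^ r ≤ |C| ^ r / c := by
      rw [le_div_iff₀ hc]
      calc u t x ^ r * c ≤ u t x ^ r * W.deg x := by gcongr; exact hdeg x
        _ ≤ C ^ r := h1
        _ ≤ |C| ^ r := (le_abs_self _).trans (Real.abs_rpow_le_abs_rpow _ _)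
    have h3 := Real.rpow_le_rpow (by positivity) h2 (z := 1 / r) (by positivity)
    rwa [← Real.rpow_mul h0, mul_one_div_cancel hr0.ne', Real.rpow_one] at h3
  · refine (summable_of_sum_le (fun x => ?_) (fun F => hfin F t ht)).congr fun x => ?_
    · have := W.deg_nonneg x; positivity
    · rw [abs_of_nonneg (hu t ht x)]

/-- Lower bound for the flow along an edge: with `D = b - a` and `b ≥ 0`, the loss is at most
linear in `a`. -/
lemma neg_le_abs_rpow_mul {D a K q : ℝ} (hq : 0 ≤ q) (hD : -a ≤ D) (ha : 0 ≤ a) (haK : a ≤ K) :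
    -(K ^ q * a) ≤ |D| ^ q * D := by
  have hK := ha.trans haK
  rcases le_total 0 D with h | h
  · have : 0 ≤ |D| ^ q * D := by positivity
    have : 0 ≤ K ^ q * a := by positivity
    linarith
  · have h1 : |D| ≤ a := by rw [abs_of_nonpos h]; linarith
    have h2 : |D| ^ q * -D ≤ K ^ q * a := by
      gcongr
      · linarith
      · exact h1.trans haK
      · linarith
    linarith

/-- Since `u` is bounded by `K`, its loss rate is at most `K ^ (p - 2)`, so that
`exp (K ^ (p - 2) t) u` is nondecreasing in time. The final value dominates all earlier ones. -/
lemma le_exp_mul_final {p T K : ℝ} {u : ℝ → V → ℝ} [Infinite V] (hp : 2 < p) (hT : 0 < T)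
    (hu : ∀ t ∈ Icc 0 T, ∀ x, 0 ≤ u t x) (huK : ∀ t ∈ Icc 0 T, ∀ x, u t x ≤ K)
    (hcont : ∀ x, ContinuousOn (fun t => u t x) (Icc 0 T))
    (heq : ∀ x, ∀ t ∈ Ioo 0 T, HasDerivAt (fun s => u s x) (W.pLaplacian p (u t) x) t) :
    ∀ t ∈ Icc 0 T, ∀ x, u t x ≤ Real.exp (K ^ (p - 2) * T) * u T x := by
  intro t ht x
  have hTm : T ∈ Icc 0 T := ⟨hT.le, le_rfl⟩
  have hK : 0 ≤ K := (hu T hTm x).trans (huK T hTm x)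
  have hl : 0 ≤ K ^ (p - 2) := by positivity
  have hlow : ∀ s ∈ Ioo 0 T, -(K ^ (p - 2) * u s x) ≤ W.pLaplacian p (u s) x := by
    intro s hs
    have hs' := Ioo_subset_Icc_self hs
    have hd := W.deg_pos x
    have h1 : -(K ^ (p - 2) * u s x) * W.deg x ≤
        ∑ y ∈ W.neighbors x, |u s y - u s x| ^ (p - 2) * (u s y - u s x) * W.weight x y := by
      rw [deg, Finset.mul_sum]
      refine Finset.sum_le_sum fun y _ => mul_le_mul_of_nonneg_right ?_ (W.weight_nonneg _ _)
      exact neg_le_abs_rpow_mul (by linarith) (by linarith [hu s hs' y]) (hu s hs' x) (huK s hs' x)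
    rw [pLaplacian, inv_mul_eq_div, le_div_iff₀ hd]
    exact h1
  have hanti : AntitoneOn (fun s => -(Real.exp (K ^ (p - 2) * s) * u s x)) (Icc 0 T) := by
    refine antitoneOn_Icc_of_hasDerivAt_nonpos
      (f' := fun s => -(Real.exp (K ^ (p - 2) * s) * (K ^ (p - 2) * 1) * u s x +
        Real.exp (K ^ (p - 2) * s) * W.pLaplacian p (u s) x)) ?_ ?_ ?_
    · exact (ContinuousOn.mul (by fun_prop) (hcont x)).neg
    · intro s hs
      exact ((((hasDerivAt_id s).const_mul (K ^ (p - 2))).exp).mul (heq x s hs)).neg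
    · intro s hs
      have h1 := mul_nonneg (Real.exp_pos (K ^ (p - 2) * s)).le
        (neg_le_iff_add_nonneg'.1 (hlow s hs))
      simp only [mul_one]
      linarith
  have h1 := hanti ht hTm ht.2
  simp only [neg_le_neg_iff] at h1
  refine le_trans (le_mul_of_one_le_left (hu t ht x) ?_) h1
  exact Real.one_le_exp (mul_nonneg hl ht.1)

/-- Jensen's inequality for the average over the neighbours. -/
lemma average_rpow_mul_deg_le [Infinite V] {f : V → ℝ} (hf : ∀ x, 0 ≤ f x) {q : ℝ} (hq : 1 ≤ q)
    (x : V) : ((W.deg x)⁻¹ * ∑ y ∈ W.neighbors x, f y * W.weight x y) ^ q * W.deg x ≤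
      ∑' y, f y ^ q * W.weight x y := by
  have hd := W.deg_pos x
  rw [(W.hasSum_mul_weight (fun y => f y ^ q) x).tsum_eq]
  have h := Real.rpow_arith_mean_le_arith_mean_rpow (W.neighbors x)
    (fun y => W.weight x y / W.deg x) f (fun y _ => div_nonneg (W.weight_nonneg _ _) hd.le)
    (by rw [← Finset.sum_div]; exact div_self hd.ne') (fun y _ => hf y) hq
  have e1 : (W.deg x)⁻¹ * ∑ y ∈ W.neighbors x, f y * W.weight x y =
      ∑ y ∈ W.neighbors x, W.weight x y / W.deg x * f y := by
    rw [Finset.mul_sum]; exact Finset.sum_congr rfl fun y _ => by ring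
  have e2 : ∑ y ∈ W.neighbors x, f y ^ q * W.weight x y =
      (∑ y ∈ W.neighbors x, W.weight x y / W.deg x * f y ^ q) * W.deg x := by
    rw [Finset.sum_mul]; exact Finset.sum_congr rfl fun y _ => by field_simp
  rw [e1, e2]
  gcongr

/-- The operator raises `u` to the power `p - 1 > 1`, so that integrability with exponent `q` at
all times entails, away from the support of the initial datum, integrability with the smaller
exponent `q / (p - 1)`. -/
lemma summable_rpow_of_summable_rpow [Infinite V] {p T K q q' L : ℝ} {u₀ g : V → ℝ}
    {u : ℝ → V → ℝ} (hp : 2 < p) (hT : 0 < T) (hu : ∀ t ∈ Icc 0 T, ∀ x, 0 ≤ u t x)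
    (hug : ∀ t ∈ Icc 0 T, ∀ x, u t x ≤ g x) (hgK : ∀ x, g x ≤ K)
    (hgu : ∀ x, g x = L * u T x) (hL : 0 ≤ L)
    (hcont : ∀ x, ContinuousOn (fun t => u t x) (Icc 0 T))
    (heq : ∀ x, ∀ t ∈ Ioo 0 T, HasDerivAt (fun s => u s x) (W.pLaplacian p (u t) x) t)
    (hinit : ∀ x, u 0 x = u₀ x) (hfin : (Function.support u₀).Finite)
    (hq : 1 ≤ q) (hq' : 1 ≤ q') (hqq : q ≤ q' * (p - 1))
    (hs : Summable fun x => g x ^ q * W.deg x) : Summable fun x => g x ^ q' * W.deg x := by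
  have hTm : T ∈ Icc 0 T := ⟨hT.le, le_rfl⟩
  have h0m : (0 : ℝ) ∈ Icc 0 T := ⟨le_rfl, hT.le⟩
  have hg0 : ∀ x, 0 ≤ g x := fun x => (hu T hTm x).trans (hug T hTm x)
  set A : V → ℝ := fun x => (W.deg x)⁻¹ * ∑ y ∈ W.neighbors x, g y ^ (p - 1) * W.weight x y
    with hA
  have hA0 : ∀ x, 0 ≤ A x := fun x => mul_nonneg (inv_nonneg.2 (W.deg_nonneg x))
    (Finset.sum_nonneg fun y _ => mul_nonneg (Real.rpow_nonneg (hg0 y) _) (W.weight_nonneg _ _))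
  have hbound : ∀ x, u T x ≤ u₀ x + T * A x := by
    intro x
    have hanti : AntitoneOn (fun s => u s x - s * A x) (Icc 0 T) := by
      refine antitoneOn_Icc_of_hasDerivAt_nonpos
        (f' := fun s => W.pLaplacian p (u s) x - 1 * A x) ?_ ?_ ?_
      · exact (hcont x).sub (by fun_prop)
      · exact fun s hs => (heq x s hs).sub ((hasDerivAt_id s).mul_const _)
      · intro s hs
        have hs' := Ioo_subset_Icc_self hs
        rw [one_mul, sub_nonpos, pLaplacian, hA]
        refine mul_le_mul_of_nonneg_left (Finset.sum_le_sum fun y _ =>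
          mul_le_mul_of_nonneg_right ?_ (W.weight_nonneg _ _)) (inv_nonneg.2 (W.deg_nonneg x))
        rcases le_total (u s y) (u s x) with h | h
        · exact (mul_nonpos_of_nonneg_of_nonpos (by positivity) (by linarith)).trans
            (Real.rpow_nonneg (hg0 y) _)
        · rw [abs_of_nonneg (sub_nonneg.2 h),
            ← Real.rpow_add_one' (sub_nonneg.2 h) (by linarith)]
          rw [show p - 2 + 1 = p - 1 by ring]
          refine Real.rpow_le_rpow (sub_nonneg.2 h) ?_ (by linarith)
          linarith [hu s hs' x, hug s hs' y]
    have h1 := hanti h0m hTm hT.le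
    simp only [zero_mul, sub_zero, hinit] at h1
    linarith
  have hsum1 : Summable fun x => (g x ^ (p - 1)) ^ q' * W.deg x := by
    refine (hs.mul_left (K ^ (q' * (p - 1) - q))).of_nonneg_of_le (fun x => ?_) fun x => ?_
    · have := W.deg_nonneg x; have := hg0 x; positivity
    · have := W.deg_nonneg x
      have h0 := hg0 x
      rw [← Real.rpow_mul h0, ← mul_assoc, mul_comm (p - 1)]
      gcongr
      calc g x ^ (q' * (p - 1)) = g x ^ (q' * (p - 1) - q) * g x ^ q := by
            rw [← Real.rpow_add' h0 (by rw [sub_add_cancel]; linarith), sub_add_cancel]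
        _ ≤ _ := by
            have := hgK x
            have : 0 ≤ q' * (p - 1) - q := by linarith
            gcongr
  have hsum2 : Summable fun x => ∑' y, (g y ^ (p - 1)) ^ q' * W.weight x y :=
    (W.summable_edge_snd (h := fun y => (g y ^ (p - 1)) ^ q')
      (fun x => by have := hg0 x; positivity) hsum1).prod
  refine Summable.of_norm_bounded_eventually (hsum2.mul_left ((L * T) ^ q')) ?_
  refine hfin.subset fun x hx => ?_
  by_contra hx0
  rw [Function.mem_support, not_not] at hx0
  refine hx ?_
  change ‖g x ^ q' * W.deg x‖ ≤ _
  have hd := W.deg_nonneg x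
  have h0 := hg0 x
  rw [Real.norm_of_nonneg (by positivity)]
  have h1 : g x ≤ L * T * A x := by
    rw [hgu, mul_assoc]
    exact mul_le_mul_of_nonneg_left (by simpa [hx0] using hbound x) hL
  calc g x ^ q' * W.deg x ≤ (L * T * A x) ^ q' * W.deg x := by gcongr
    _ = (L * T) ^ q' * (A x ^ q' * W.deg x) := by
        rw [Real.mul_rpow (by positivity) (hA0 x), mul_assoc]
    _ ≤ _ := by
        gcongr
        exact average_rpow_mul_deg_le (f := fun y => g y ^ (p - 1))
          (fun y => Real.rpow_nonneg (hg0 y) _) hq' x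

/-- A solution in some `ℓ^r` with finitely supported initial datum has finite mass, uniformly in
time. -/
lemma IsSolution.exists_isDominated [Infinite V] {p r T c : ℝ} {u₀ : V → ℝ} {u : ℝ → V → ℝ}
    (hsol : W.IsSolution p r T u₀ u) (hp : 2 < p) (hr : 1 ≤ r) (hT : 0 < T) (hc : 0 < c)
    (hdeg : ∀ x, c ≤ W.deg x) (hu : ∀ t ∈ Icc 0 T, ∀ x, 0 ≤ u t x)
    (hfin : (Function.support u₀).Finite) : ∃ K g, W.IsDominated p T K u g := by
  obtain ⟨⟨K, hK0, hK⟩, hsum⟩ := hsol.exists_bound hr hT hc hdeg hu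
  have hTm : T ∈ Icc 0 T := ⟨hT.le, le_rfl⟩
  have hcont : ∀ x, ContinuousOn (fun t => u t x) (Icc 0 T) :=
    fun x => (hsol.contDiffOn x).continuousOn
  set L := Real.exp (K ^ (p - 2) * T) with hLdef
  have hL : 0 ≤ L := (Real.exp_pos _).le
  have hug := le_exp_mul_final hp hT hu hK hcont hsol.equation
  have hgK : ∀ x, L * u T x ≤ L * K := fun x => mul_le_mul_of_nonneg_left (hK T hTm x) hL
  have hr' : Summable fun x => (L * u T x) ^ r * W.deg x := by
    refine ((hsum T hTm).mul_left (L ^ r)).congr fun x => ?_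
    rw [Real.mul_rpow hL (hu T hTm x), mul_assoc]
  have hp1 : 1 < p - 1 := by linarith
  have hiter : ∀ n : ℕ, Summable fun x => (L * u T x) ^ (max 1 (r / (p - 1) ^ n)) * W.deg x := by
    intro n
    induction n with
    | zero => simpa [max_eq_right hr] using hr'
    | succ n ih =>
      refine summable_rpow_of_summable_rpow hp hT hu hug hgK (fun x => rfl) hL hcont hsol.equation
        hsol.initial hfin (le_max_left _ _) (le_max_left _ _) ?_ ih
      have h1 := le_max_left 1 (r / (p - 1) ^ (n + 1))
      have h2 := le_max_right 1 (r / (p - 1) ^ (n + 1))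
      refine max_le (by nlinarith) ?_
      calc r / (p - 1) ^ n = r / (p - 1) ^ (n + 1) * (p - 1) := by
            rw [pow_succ]; field_simp
        _ ≤ _ := by gcongr
  obtain ⟨n, hn⟩ := pow_unbounded_of_one_lt r hp1
  have h1 := hiter n
  rw [max_eq_left ((div_le_one (by positivity)).2 hn.le)] at h1
  exact ⟨L * K, fun x => L * u T x, hu, hug, hgK, by simpa using h1, hcont, hsol.equation⟩

end WeightedGraph

/-! ### Time derivatives of weighted sums and the dissipation -/

namespace WeightedGraph

variable {V : Type*} {W : WeightedGraph V}

/-- The density, at one edge, of the dissipation of the sum of `f ^ (1 + θ)`. -/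
noncomputable def dissipationDensity (W : WeightedGraph V) (p θ : ℝ) (f : V → ℝ) (z : V × V) : ℝ :=
  |f z.2 - f z.1| ^ (p - 1) * |f z.2 ^ θ - f z.1 ^ θ| * W.weight z.1 z.2

lemma dissipationDensity_nonneg (p θ : ℝ) (f : V → ℝ) (z : V × V) :
    0 ≤ W.dissipationDensity p θ f z := by
  have := W.weight_nonneg z.1 z.2
  unfold dissipationDensity
  positivity

lemma rpow_sub_mul_flow {p θ : ℝ} (hp : 2 < p) (hθ : 0 < θ) {f : V → ℝ} (f0 : ∀ x, 0 ≤ f x)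
    (z : V × V) : (f z.2 ^ θ - f z.1 ^ θ) * W.flow p f z = W.dissipationDensity p θ f z := by
  have hs : 0 ≤ (f z.2 ^ θ - f z.1 ^ θ) * (f z.2 - f z.1) := by
    rcases le_total (f z.1) (f z.2) with h | h
    · exact mul_nonneg (sub_nonneg.2 (Real.rpow_le_rpow (f0 _) h hθ.le)) (sub_nonneg.2 h)
    · exact mul_nonneg_of_nonpos_of_nonpos
        (sub_nonpos.2 (Real.rpow_le_rpow (f0 _) h hθ.le)) (sub_nonpos.2 h)
  have h1 : |f z.2 - f z.1| ^ (p - 1) = |f z.2 - f z.1| ^ (p - 2) * |f z.2 - f z.1| := by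
    rw [← Real.rpow_add_one' (abs_nonneg _) (by linarith)]; ring_nf
  rw [dissipationDensity, flow, h1]
  calc _ = |f z.2 - f z.1| ^ (p - 2) * ((f z.2 ^ θ - f z.1 ^ θ) * (f z.2 - f z.1)) *
        W.weight z.1 z.2 := by ring
    _ = |f z.2 - f z.1| ^ (p - 2) * (|f z.2 ^ θ - f z.1 ^ θ| * |f z.2 - f z.1|) *
        W.weight z.1 z.2 := by rw [← abs_mul, abs_of_nonneg hs]
    _ = _ := by ring

/-- The total dissipation `∑ |D f|^(p-1) |D f^θ|`, over ordered pairs of neighbours. -/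
noncomputable def dissipation (W : WeightedGraph V) (p θ : ℝ) (f : V → ℝ) : ℝ :=
  ∑' z : V × V, W.dissipationDensity p θ f z

lemma dissipation_nonneg (p θ : ℝ) (f : V → ℝ) : 0 ≤ W.dissipation p θ f :=
  tsum_nonneg fun _ => dissipationDensity_nonneg _ _ _ _

namespace IsDominated

variable {p T K : ℝ} {u : ℝ → V → ℝ} {g : V → ℝ}

lemma majorant_nonneg (D : W.IsDominated p T K u g) (hT : 0 ≤ T) (x : V) : 0 ≤ g x :=
  (D.nonneg 0 ⟨le_rfl, hT⟩ x).trans (D.le_majorant 0 ⟨le_rfl, hT⟩ x)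

lemma le_bound (D : W.IsDominated p T K u g) {t : ℝ} (ht : t ∈ Icc 0 T) (x : V) : u t x ≤ K :=
  (D.le_majorant t ht x).trans (D.majorant_le x)

lemma summable_flow_bound (D : W.IsDominated p T K u g) (hT : 0 ≤ T) :
    Summable fun z : V × V => K ^ (p - 2) * ((g z.1 + g z.2) * W.weight z.1 z.2) :=
  (W.summable_edge_add (D.majorant_nonneg hT) D.summable).mul_left _

lemma abs_flow_le (D : W.IsDominated p T K u g) (hp : 2 < p) {t : ℝ} (ht : t ∈ Icc 0 T)
    (z : V × V) :
    |W.flow p (u t) z| ≤ K ^ (p - 2) * ((g z.1 + g z.2) * W.weight z.1 z.2) :=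
  W.abs_flow_le hp (D.nonneg t ht) (D.le_majorant t ht) D.majorant_le z

lemma summable_flow (D : W.IsDominated p T K u g) (hp : 2 < p) {t : ℝ} (ht : t ∈ Icc 0 T) :
    Summable (W.flow p (u t)) :=
  (D.summable_flow_bound (ht.1.trans ht.2)).of_norm_bounded (D.abs_flow_le hp ht)

lemma summable_mass (D : W.IsDominated p T K u g) {t : ℝ} (ht : t ∈ Icc 0 T) :
    Summable fun x => u t x * W.deg x :=
  D.summable.of_nonneg_of_le (fun x => mul_nonneg (D.nonneg t ht x) (W.deg_nonneg x))
    fun x => mul_le_mul_of_nonneg_right (D.le_majorant t ht x) (W.deg_nonneg x)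

lemma abs_rpow_mul_le (D : W.IsDominated p T K u g) {q B : ℝ} {h : V → ℝ} (hq : 1 ≤ q)
    (hB : ∀ x, |h x| ≤ B) {t : ℝ} (ht : t ∈ Icc 0 T) (x : V) :
    ‖u t x ^ q * h x * W.deg x‖ ≤ K ^ (q - 1) * B * (g x * W.deg x) := by
  have h0 := D.nonneg t ht x
  have hd := W.deg_nonneg x
  have hK := D.le_bound ht x
  have hK0 := h0.trans hK
  have h1 : u t x ^ q ≤ K ^ (q - 1) * g x := by
    calc u t x ^ q = u t x ^ (q - 1) * u t x := by
          rw [← Real.rpow_add_one' h0 (by linarith), sub_add_cancel]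
      _ ≤ _ := by
          have := D.le_majorant t ht x
          have : 0 ≤ q - 1 := by linarith
          gcongr
  have h2 : 0 ≤ g x := h0.trans (D.le_majorant t ht x)
  rw [norm_mul, norm_mul, Real.norm_of_nonneg hd, Real.norm_of_nonneg (by positivity)]
  calc u t x ^ q * ‖h x‖ * W.deg x ≤ K ^ (q - 1) * g x * B * W.deg x := by
        gcongr
        exact hB x
    _ = _ := by ring

lemma summable_rpow_mul (D : W.IsDominated p T K u g) {q B : ℝ} {h : V → ℝ} (hq : 1 ≤ q)
    (hB : ∀ x, |h x| ≤ B) {t : ℝ} (ht : t ∈ Icc 0 T) :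
    Summable fun x => u t x ^ q * h x * W.deg x :=
  (D.summable.mul_left _).of_norm_bounded (D.abs_rpow_mul_le hq hB ht)

lemma continuousOn_tsum_rpow (D : W.IsDominated p T K u g) {q B : ℝ} {h : V → ℝ} (hq : 1 ≤ q)
    (hB : ∀ x, |h x| ≤ B) :
    ContinuousOn (fun t => ∑' x, u t x ^ q * h x * W.deg x) (Icc 0 T) := by
  refine continuousOn_tsum (fun x => ?_) (D.summable.mul_left _)
    fun x t ht => D.abs_rpow_mul_le hq hB ht x
  exact (((D.continuousOn x).rpow_const fun _ _ => Or.inr (by linarith)).mul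
    continuousOn_const).mul continuousOn_const

/-- The weak form of the equation, tested with `q u ^ (q - 1) h`. -/
lemma hasDerivAt_tsum_rpow [Infinite V] (D : W.IsDominated p T K u g) (hp : 2 < p) {q B : ℝ}
    {h : V → ℝ} (hq : 1 ≤ q) (hB : ∀ x, |h x| ≤ B) {t : ℝ} (ht : t ∈ Ioo 0 T) :
    HasDerivAt (fun s => ∑' x, u s x ^ q * h x * W.deg x)
      (-(q / 2) * ∑' z : V × V, (u t z.2 ^ (q - 1) * h z.2 - u t z.1 ^ (q - 1) * h z.1) *
        W.flow p (u t) z) t := by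
  have hT : 0 ≤ T := (ht.1.trans ht.2).le
  have ht' := Ioo_subset_Icc_self ht
  have hK0 : ∀ s ∈ Ioo 0 T, ∀ x, u s x ^ (q - 1) ≤ K ^ (q - 1) := fun s hs x =>
    Real.rpow_le_rpow (D.nonneg s (Ioo_subset_Icc_self hs) x)
      (D.le_bound (Ioo_subset_Icc_self hs) x) (by linarith)
  set G : V → ℝ := fun x => ∑' y, K ^ (p - 2) * ((g x + g y) * W.weight x y) with hG
  have hGs : Summable G := (D.summable_flow_bound hT).prod
  have hflow : ∀ s ∈ Ioo 0 T, ∀ x, |∑' y, W.flow p (u s) (x, y)| ≤ G x := by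
    intro s hs x
    have hs' := Ioo_subset_Icc_self hs
    exact tsum_of_norm_bounded (f := fun y => W.flow p (u s) (x, y))
      ((D.summable_flow_bound hT).prod_factor x).hasSum fun y => D.abs_flow_le hp hs' (x, y)
  have hder : ∀ x, ∀ s ∈ Ioo 0 T, HasDerivAt (fun s => u s x ^ q * h x * W.deg x)
      (q * (u s x ^ (q - 1) * h x) * ∑' y, W.flow p (u s) (x, y)) s := by
    intro x s hs
    have h1 := (((D.equation x s hs).rpow_const (p := q) (Or.inr hq)).mul_const (h x)).mul_const
      (W.deg x)
    refine h1.congr_deriv ?_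
    rw [← W.pLaplacian_mul_deg]
    ring
  have hbd : ∀ x, ∀ s ∈ Ioo 0 T,
      ‖q * (u s x ^ (q - 1) * h x) * ∑' y, W.flow p (u s) (x, y)‖ ≤ q * (K ^ (q - 1) * B) * G x := by
    intro x s hs
    have h0 := D.nonneg s (Ioo_subset_Icc_self hs) x
    rw [norm_mul, norm_mul, norm_mul, Real.norm_of_nonneg (by linarith : 0 ≤ q),
      Real.norm_of_nonneg (by positivity : 0 ≤ u s x ^ (q - 1))]
    have h1 := hK0 s hs x
    have h2 : 0 ≤ K ^ (q - 1) := le_trans (by positivity) h1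
    have h3 : 0 ≤ B := (abs_nonneg _).trans (hB x)
    gcongr
    · exact hB x
    · exact hflow s hs x
  have hmain := hasDerivAt_tsum_of_isPreconnected (hGs.mul_left (q * (K ^ (q - 1) * B))) isOpen_Ioo
    isPreconnected_Ioo hder hbd ht (D.summable_rpow_mul hq hB ht') ht
  refine hmain.congr_deriv ?_
  have hH : ∀ x, |u t x ^ (q - 1) * h x| ≤ K ^ (q - 1) * B := by
    intro x
    have h0 := D.nonneg t ht' x
    rw [abs_mul, abs_of_nonneg (by positivity)]
    have h1 := hK0 t ht x
    have h2 : 0 ≤ K ^ (q - 1) := le_trans (by positivity) h1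
    gcongr
    exact hB x
  have hparts := tsum_mul_antisymm (D.summable_flow hp ht') (W.flow_swap p (u t)) hH
  simp only [mul_assoc q]
  rw [tsum_mul_left, hparts]
  ring

lemma summable_dissipation (D : W.IsDominated p T K u g) (hp : 2 < p) {θ : ℝ} (hθ : 0 < θ)
    {t : ℝ} (ht : t ∈ Icc 0 T) : Summable (W.dissipationDensity p θ (u t)) := by
  refine ((D.summable_flow hp ht).norm.mul_left (K ^ θ)).of_nonneg_of_le
    (dissipationDensity_nonneg _ _ _) fun z => ?_
  rw [← rpow_sub_mul_flow hp hθ (D.nonneg t ht)]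
  refine (le_abs_self _).trans ?_
  rw [abs_mul]
  refine mul_le_mul_of_nonneg_right ?_ (abs_nonneg _)
  have h : ∀ x, 0 ≤ u t x ^ θ ∧ u t x ^ θ ≤ K ^ θ := fun x =>
    ⟨Real.rpow_nonneg (D.nonneg t ht x) _,
      Real.rpow_le_rpow (D.nonneg t ht x) (D.le_bound ht x) hθ.le⟩
  rw [abs_le]
  constructor <;> linarith [h z.1, h z.2]

/-- The sum of `u ^ (1 + θ)` decreases at the rate given by the dissipation. -/
lemma hasDerivAt_tsum_rpow_one_add [Infinite V] (D : W.IsDominated p T K u g) (hp : 2 < p) {θ : ℝ}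
    (hθ : 0 < θ) {t : ℝ} (ht : t ∈ Ioo 0 T) :
    HasDerivAt (fun s => ∑' x, u s x ^ (1 + θ) * W.deg x)
      (-((1 + θ) / 2 * W.dissipation p θ (u t))) t := by
  have h := D.hasDerivAt_tsum_rpow hp (q := 1 + θ) (h := fun _ => 1) (B := 1) (by linarith)
    (by simp) ht
  simp only [mul_one, add_sub_cancel_left,
    rpow_sub_mul_flow hp hθ (D.nonneg t (Ioo_subset_Icc_self ht))] at h
  rw [neg_mul] at h
  exact h

lemma continuousOn_tsum_rpow_one_add (D : W.IsDominated p T K u g) {θ : ℝ} (hθ : 0 < θ) :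
    ContinuousOn (fun s => ∑' x, u s x ^ (1 + θ) * W.deg x) (Icc 0 T) := by
  simpa using D.continuousOn_tsum_rpow (q := 1 + θ) (h := fun _ => 1) (B := 1) (by linarith)
    (by simp)

lemma summable_rpow_one_add (D : W.IsDominated p T K u g) {θ : ℝ} (hθ : 0 < θ) {t : ℝ}
    (ht : t ∈ Icc 0 T) : Summable fun x => u t x ^ (1 + θ) * W.deg x := by
  simpa using D.summable_rpow_mul (q := 1 + θ) (h := fun _ => 1) (B := 1) (by linarith)
    (by simp) ht

/-- The weak form of the equation, tested with a bounded function of the vertex. -/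
lemma hasDerivAt_tsum_mul [Infinite V] (D : W.IsDominated p T K u g) (hp : 2 < p) {φ : V → ℝ}
    {B : ℝ} (hB : ∀ x, |φ x| ≤ B) {t : ℝ} (ht : t ∈ Ioo 0 T) :
    HasDerivAt (fun s => ∑' x, u s x * φ x * W.deg x)
      (-(1 / 2) * ∑' z : V × V, (φ z.2 - φ z.1) * W.flow p (u t) z) t := by
  simpa using D.hasDerivAt_tsum_rpow hp (q := 1) le_rfl hB ht

lemma continuousOn_tsum_mul (D : W.IsDominated p T K u g) {φ : V → ℝ} {B : ℝ}
    (hB : ∀ x, |φ x| ≤ B) : ContinuousOn (fun s => ∑' x, u s x * φ x * W.deg x) (Icc 0 T) := by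
  simpa using D.continuousOn_tsum_rpow (q := 1) le_rfl hB

lemma summable_mul (D : W.IsDominated p T K u g) {φ : V → ℝ} {B : ℝ}
    (hB : ∀ x, |φ x| ≤ B) {t : ℝ} (ht : t ∈ Icc 0 T) :
    Summable fun x => u t x * φ x * W.deg x := by
  simpa using D.summable_rpow_mul (q := 1) le_rfl hB ht

/-- Conservation of mass. -/
lemma mass_eq [Infinite V] (D : W.IsDominated p T K u g) (hp : 2 < p) {t : ℝ}
    (ht : t ∈ Icc 0 T) : ∑' x, u t x * W.deg x = ∑' x, u 0 x * W.deg x := by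
  have hB : ∀ x : V, |(fun _ => 1 : V → ℝ) x| ≤ 1 := by simp
  have hc := D.continuousOn_tsum_mul hB
  have hd : ∀ s ∈ Ioo 0 T, HasDerivAt (fun s => ∑' x, u s x * 1 * W.deg x) 0 s := fun s hs => by
    simpa using D.hasDerivAt_tsum_mul hp hB hs
  have h0 : (0 : ℝ) ∈ Icc 0 T := ⟨le_rfl, ht.1.trans ht.2⟩
  have h1 := antitoneOn_Icc_of_hasDerivAt_nonpos hc hd (fun _ _ => le_rfl) h0 ht ht.1
  have h2 := antitoneOn_Icc_of_hasDerivAt_nonpos hc.neg (fun s hs => (hd s hs).neg)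
    (fun _ _ => by simp) h0 ht ht.1
  simp only [mul_one, Pi.neg_apply, neg_le_neg_iff] at h1 h2
  exact le_antisymm h1 h2

end IsDominated

/-! ### The Nash inequality -/

/-- The Faber-Krahn inequality for the truncation `(f ^ σ - k ^ σ)₊`, `σ = (p + θ - 1) / p`, which
lives on the set `{f > k}` of measure at most `M / k`. -/
lemma tsum_truncation_le [Infinite V] {p N κ θ c : ℝ} {Λ : ℝ → ℝ} (hp : 2 < p) (hθ : 0 < θ)
    (hθ1 : θ ≤ 1) (hΛ : IsFaberKrahnFunction p N κ Λ) (hFK : W.FaberKrahn p Λ) (hc : 0 < c)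
    (hdeg : ∀ x, c ≤ W.deg x) {f : V → ℝ} (f0 : ∀ x, 0 ≤ f x)
    (hs : Summable fun x => f x * W.deg x) (hE : Summable (W.dissipationDensity p θ f))
    {k : ℝ} (hk : 0 < k) (hM : 0 < ∑' x, f x * W.deg x) :
    (Summable fun x => max (f x ^ ((p + θ - 1) / p) - k ^ ((p + θ - 1) / p)) 0 ^ p * W.deg x) ∧
    ∑' x, max (f x ^ ((p + θ - 1) / p) - k ^ ((p + θ - 1) / p)) 0 ^ p * W.deg x ≤
      (Λ ((∑' x, f x * W.deg x) / k))⁻¹ * (θ⁻¹ * W.dissipation p θ f) := by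
  classical
  set M := ∑' x, f x * W.deg x with hMdef
  set σ := (p + θ - 1) / p with hσdef
  have hp0 : 0 < p := by linarith
  have hσ0 : 0 < σ := by apply div_pos <;> linarith
  set F : V → ℝ := fun x => max (f x ^ σ - k ^ σ) 0 with hF
  have hΛM := hΛ.pos (M / k) (by positivity)
  have hE0 := W.dissipation_nonneg p θ f
  have hfin : {x | k < f x}.Finite := by
    have h1 := hs.tendsto_cofinite_zero.eventually (gt_mem_nhds (show 0 < k * c by positivity))
    refine (Filter.eventually_cofinite.1 h1).subset fun x hx => ?_
    simp only [mem_ofPred_eq, not_lt] at hx ⊢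
    exact mul_le_mul hx.le (hdeg x) hc.le (f0 x)
  set U := hfin.toFinset with hU
  have hFU : ∀ x, x ∉ U → F x = 0 := by
    intro x hx
    have hx' : f x ≤ k := by simpa [hU] using hx
    exact max_eq_right (sub_nonpos.2 (Real.rpow_le_rpow (f0 x) hx' hσ0.le))
  have hFs : ∀ x, x ∉ U → F x ^ p * W.deg x = 0 := fun x hx => by
    rw [hFU x hx, Real.zero_rpow hp0.ne', zero_mul]
  refine ⟨summable_of_ne_finset_zero hFs, ?_⟩
  change ∑' x, F x ^ p * W.deg x ≤ _
  rw [tsum_eq_sum hFs]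
  rcases U.eq_empty_or_nonempty with hUe | hUne
  · rw [hUe, Finset.sum_empty]; positivity
  have hv : 0 < ∑ x ∈ U, W.deg x := Finset.sum_pos (fun x _ => W.deg_pos x) hUne
  have hvM : ∑ x ∈ U, W.deg x ≤ M / k := by
    rw [le_div_iff₀ hk, Finset.sum_mul]
    calc ∑ x ∈ U, W.deg x * k ≤ ∑ x ∈ U, f x * W.deg x := by
          refine Finset.sum_le_sum fun x hx => ?_
          rw [mul_comm]
          have hx' : k < f x := by simpa [hU] using hx
          exact mul_le_mul_of_nonneg_right hx'.le (W.deg_nonneg x)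
      _ ≤ M := hs.sum_le_tsum U fun x _ => mul_nonneg (f0 x) (W.deg_nonneg x)
  have hΛv := hΛ.antitoneOn (mem_Ioi.2 hv) (mem_Ioi.2 (show 0 < M / k by positivity)) hvM
  have hpt : ∀ z : V × V, |F z.2 - F z.1| ^ p * W.weight z.1 z.2 ≤
      θ⁻¹ * W.dissipationDensity p θ f z := by
    intro z
    rw [dissipationDensity, ← mul_assoc]
    refine mul_le_mul_of_nonneg_right ?_ (W.weight_nonneg _ _)
    refine le_trans ?_ (abs_rpow_sub_rpow_rpow_le (f0 z.1) (f0 z.2) (by linarith) hθ hθ1)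
    refine Real.rpow_le_rpow (abs_nonneg _) ?_ hp0.le
    have := abs_max_sub_max_le_abs (f z.2 ^ σ - k ^ σ) (f z.1 ^ σ - k ^ σ) 0
    rwa [sub_sub_sub_cancel_right] at this
  have h0 : ∀ z : V × V, 0 ≤ |F z.2 - F z.1| ^ p * W.weight z.1 z.2 := fun z =>
    mul_nonneg (by positivity) (W.weight_nonneg _ _)
  have hsum : Summable fun z : V × V => |F z.2 - F z.1| ^ p * W.weight z.1 z.2 :=
    (hE.mul_left _).of_nonneg_of_le h0 hpt
  have h1 := hFK _ hv U rfl F hFU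
  have h2 := tsum_subtype_prod_le hsum h0 (W.nbhd (U : Set V))
  have h3 := hsum.tsum_le_tsum hpt (hE.mul_left _)
  rw [tsum_mul_left] at h3
  have hF0 : ∀ x, 0 ≤ F x := fun x => le_max_right _ _
  have h4 : ∑ x ∈ U, |F x| ^ p * W.deg x = ∑ x ∈ U, F x ^ p * W.deg x :=
    Finset.sum_congr rfl fun x _ => by rw [abs_of_nonneg (hF0 x)]
  rw [h4] at h1
  have h5 : 0 ≤ ∑ x ∈ U, F x ^ p * W.deg x := Finset.sum_nonneg fun x _ =>
    mul_nonneg (Real.rpow_nonneg (hF0 x) _) (W.deg_nonneg x)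
  rw [inv_mul_eq_div, le_div_iff₀ hΛM, mul_comm]
  calc _ ≤ _ := mul_le_mul_of_nonneg_right hΛv h5
    _ ≤ _ := h1.trans (h2.trans h3)

/-- A Nash-type inequality: the sum of `f ^ (1 + θ)` is split at the level `2 k`; below it the
mass is used, above it the Faber-Krahn inequality. -/
lemma nash_inequality [Infinite V] {p N κ θ c : ℝ} {Λ : ℝ → ℝ} (hp : 2 < p) (hθ : 0 < θ)
    (hθ1 : θ ≤ 1) (hΛ : IsFaberKrahnFunction p N κ Λ) (hFK : W.FaberKrahn p Λ) (hc : 0 < c)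
    (hdeg : ∀ x, c ≤ W.deg x) {f : V → ℝ} (f0 : ∀ x, 0 ≤ f x)
    (hs : Summable fun x => f x * W.deg x) (hs1 : Summable fun x => f x ^ (1 + θ) * W.deg x)
    (hE : Summable (W.dissipationDensity p θ f)) {k : ℝ} (hk : 0 < k)
    (hM : 0 < ∑' x, f x * W.deg x) :
    ∑' x, f x ^ (1 + θ) * W.deg x ≤ (2 * k) ^ θ * ∑' x, f x * W.deg x +
      (1 - 2 ^ (-((p + θ - 1) / p))) ^ (-p) * θ⁻¹ *
        (k ^ (2 - p) * (Λ ((∑' x, f x * W.deg x) / k))⁻¹ * W.dissipation p θ f) := by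
  obtain ⟨hFs, hF⟩ := tsum_truncation_le hp hθ hθ1 hΛ hFK hc hdeg f0 hs hE hk hM
  set σ := (p + θ - 1) / p with hσdef
  have hp0 : 0 < p := by linarith
  have hσ0 : 0 < σ := by apply div_pos <;> linarith
  have hb : 0 < 1 - (2 : ℝ) ^ (-σ) := by
    have : (2 : ℝ) ^ (-σ) < 1 := Real.rpow_lt_one_of_one_lt_of_neg (by norm_num) (by linarith)
    linarith
  set b := 1 - (2 : ℝ) ^ (-σ) with hbdef
  have hpt : ∀ x, f x ^ (1 + θ) * W.deg x ≤ (2 * k) ^ θ * (f x * W.deg x) +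
      b ^ (-p) * k ^ (2 - p) * (max (f x ^ σ - k ^ σ) 0 ^ p * W.deg x) := by
    intro x
    have h0 := f0 x
    have hd := W.deg_nonneg x
    suffices f x ^ (1 + θ) ≤ (2 * k) ^ θ * f x + b ^ (-p) * k ^ (2 - p) *
        max (f x ^ σ - k ^ σ) 0 ^ p by
      have := mul_le_mul_of_nonneg_right this hd
      linarith
    have hF0 : 0 ≤ max (f x ^ σ - k ^ σ) 0 := le_max_right _ _
    rcases le_total (f x) (2 * k) with h | h
    · have h1 : f x ^ (1 + θ) ≤ (2 * k) ^ θ * f x := by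
        rw [add_comm, Real.rpow_add_one' h0 (by linarith)]
        gcongr
      have : 0 ≤ b ^ (-p) * k ^ (2 - p) * max (f x ^ σ - k ^ σ) 0 ^ p := by positivity
      linarith
    · have hf : 0 < f x := by linarith
      have h1 : b * f x ^ σ ≤ max (f x ^ σ - k ^ σ) 0 := by
        refine le_trans ?_ (le_max_left _ _)
        have : k ^ σ ≤ 2 ^ (-σ) * f x ^ σ := by
          calc k ^ σ ≤ (2⁻¹ * f x) ^ σ := by gcongr; linarith
            _ = _ := by rw [Real.mul_rpow (by norm_num) h0, Real.inv_rpow (by norm_num),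
                Real.rpow_neg (by norm_num)]
        rw [hbdef]; linarith
      have h2 : f x ^ (p + θ - 1) ≤ b ^ (-p) * max (f x ^ σ - k ^ σ) 0 ^ p := by
        have h3 := Real.rpow_le_rpow (by positivity) h1 hp0.le
        rw [Real.mul_rpow hb.le (by positivity), ← Real.rpow_mul h0,
          show σ * p = p + θ - 1 by rw [hσdef]; field_simp] at h3
        rw [Real.rpow_neg hb.le, inv_mul_eq_div, le_div_iff₀ (by positivity), mul_comm]
        exact h3
      have h4 : f x ^ (2 - p) ≤ k ^ (2 - p) :=
        Real.rpow_le_rpow_of_nonpos hk (by linarith) (by linarith)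
      have h5 : f x ^ (1 + θ) = f x ^ (2 - p) * f x ^ (p + θ - 1) := by
        rw [← Real.rpow_add hf]; ring_nf
      have h6 : f x ^ (1 + θ) ≤ k ^ (2 - p) * (b ^ (-p) * max (f x ^ σ - k ^ σ) 0 ^ p) := by
        rw [h5]; gcongr
      have : 0 ≤ (2 * k) ^ θ * f x := by positivity
      linarith
  have h1 := hs1.tsum_le_tsum hpt ((hs.mul_left _).add (hFs.mul_left _))
  rw [(hs.mul_left _).tsum_add (hFs.mul_left _), tsum_mul_left, tsum_mul_left] at h1
  refine h1.trans (add_le_add le_rfl ?_)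
  calc _ ≤ b ^ (-p) * k ^ (2 - p) * ((Λ ((∑' x, f x * W.deg x) / k))⁻¹ *
        (θ⁻¹ * W.dissipation p θ f)) := by gcongr
    _ = _ := by ring

end WeightedGraph

/-! ### Differential inequalities -/

/-- Decay from `Y' ≤ -c Y ψ(A Y^(1/θ))`, when `ψ` grows at least like the power `a`: the power
`-a / θ` of `Y` then grows at least linearly. -/
lemma mul_le_one_of_deriv_le {Y Y' ψ : ℝ → ℝ} {t c a θ A : ℝ} (ht : 0 < t) (hc : 0 ≤ c)
    (ha : 0 < a) (hθ : 0 < θ) (hA : 0 < A) (hψ : ∀ s, 0 < s → 0 < ψ s)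
    (hmono : ∀ r s, 0 < r → r ≤ s → ψ r / r ^ a ≤ ψ s / s ^ a)
    (hYc : ContinuousOn Y (Icc 0 t)) (hY0 : ∀ s ∈ Icc 0 t, 0 < Y s)
    (hYd : ∀ s ∈ Ioo 0 t, HasDerivAt Y (Y' s) s)
    (hle : ∀ s ∈ Ioo 0 t, Y' s ≤ -(c * Y s * ψ (A * Y s ^ (1 / θ)))) :
    c * (a / θ) * t * ψ (A * Y t ^ (1 / θ)) ≤ 1 := by
  have htm : t ∈ Icc 0 t := ⟨ht.le, le_rfl⟩
  have h0m : (0 : ℝ) ∈ Icc 0 t := ⟨le_rfl, ht.le⟩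
  have hw0 : ∀ s ∈ Icc 0 t, 0 < A * Y s ^ (1 / θ) := fun s hs => by
    have := hY0 s hs; positivity
  have hanti : AntitoneOn Y (Icc 0 t) := by
    refine antitoneOn_Icc_of_hasDerivAt_nonpos hYc hYd fun s hs => (hle s hs).trans ?_
    have hs' := Ioo_subset_Icc_self hs
    have h1 := hY0 s hs'
    have h2 := hψ _ (hw0 s hs')
    rw [neg_nonpos]; positivity
  set w := A * Y t ^ (1 / θ) with hw
  have hw0' : 0 < w := hw0 t htm
  set Q := ψ w / w ^ a with hQ
  have hpow : ∀ s ∈ Icc 0 t, (A * Y s ^ (1 / θ)) ^ (-a) = A ^ (-a) * Y s ^ (-(a / θ)) := by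
    intro s hs
    have h1 := hY0 s hs
    rw [Real.mul_rpow hA.le (by positivity), ← Real.rpow_mul h1.le]
    congr 2; field_simp
  have hf : AntitoneOn (fun s => c * (a / θ) * Q * s - A ^ (-a) * Y s ^ (-(a / θ))) (Icc 0 t) := by
    refine antitoneOn_Icc_of_hasDerivAt_nonpos
      (f' := fun s => c * (a / θ) * Q * 1 -
        A ^ (-a) * (Y' s * (-(a / θ)) * Y s ^ (-(a / θ) - 1))) ?_ ?_ ?_
    · refine ContinuousOn.sub (by fun_prop) (continuousOn_const.mul ?_)
      exact hYc.rpow_const fun s hs => Or.inl (hY0 s hs).ne'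
    · intro s hs
      have h1 := hY0 s (Ioo_subset_Icc_self hs)
      exact ((hasDerivAt_id s).const_mul _).sub
        (((hYd s hs).rpow_const (Or.inl h1.ne')).const_mul _)
    · intro s hs
      have hs' := Ioo_subset_Icc_self hs
      have h1 := hY0 s hs'
      have hws := hw0 s hs'
      have hle' : w ≤ A * Y s ^ (1 / θ) := by
        have := hanti hs' htm hs'.2
        have := hY0 t htm
        rw [hw]; gcongr
      have h2 := hmono _ _ hw0' hle'
      rw [← hQ, div_eq_mul_inv, ← Real.rpow_neg hws.le, hpow s hs'] at h2
      have h3 := hle s hs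
      have h4 : Y s ^ (-(a / θ)) = Y s ^ (-(a / θ) - 1) * Y s := by
        rw [← Real.rpow_add_one h1.ne', sub_add_cancel]
      have h5 : A ^ (-a) * ((a / θ) * Y s ^ (-(a / θ) - 1)) * Y' s ≤
          A ^ (-a) * ((a / θ) * Y s ^ (-(a / θ) - 1)) *
            -(c * Y s * ψ (A * Y s ^ (1 / θ))) := by gcongr
      have h6 : c * (a / θ) * Q ≤
          c * (a / θ) * (ψ (A * Y s ^ (1 / θ)) * (A ^ (-a) * Y s ^ (-(a / θ)))) := by gcongr
      rw [h4] at h6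
      linarith
  have h1 := hf h0m htm ht.le
  simp only [mul_zero, zero_sub] at h1
  have h2 : 0 ≤ A ^ (-a) * Y 0 ^ (-(a / θ)) := by have := hY0 0 h0m; positivity
  have h3 : c * (a / θ) * Q * t ≤ w ^ (-a) := by rw [hw, hpow t htm]; linarith
  rw [Real.rpow_neg hw0'.le, hQ] at h3
  have hwa : 0 < w ^ a := by positivity
  have h4 := mul_le_mul_of_nonneg_right h3 hwa.le
  rw [inv_mul_cancel₀ hwa.ne'] at h4
  calc _ = c * (a / θ) * (ψ w / w ^ a) * t * w ^ a := by field_simp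
    _ ≤ 1 := h4

/-- Integration of the flux inequality `m' ≤ L (λ E + A λ^(-q))`, valid for every `λ > 0`, along
`λ = λ₀ (s / t)^β`, when `Y' = -c E` and `Y` blows up at time zero at most like `s^(-δ)`. The
conditions on `β` make the two resulting powers of `s` integrable at zero. -/
lemma le_add_of_flux_le {m m' Y E : ℝ → ℝ} {t L lam A B c q β δ : ℝ} (ht : 0 < t) (hL : 0 ≤ L)
    (hlam : 0 < lam) (hc : 0 < c) (hδ : 0 ≤ δ) (hδβ : δ < β) (hβq : β * q < 1)
    (hmc : ContinuousOn m (Icc 0 t)) (hYc : ContinuousOn Y (Icc 0 t))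
    (hmd : ∀ s ∈ Ioo 0 t, HasDerivAt m (m' s) s)
    (hYd : ∀ s ∈ Ioo 0 t, HasDerivAt Y (-(c * E s)) s)
    (hflux : ∀ s ∈ Ioo 0 t, ∀ l, 0 < l → m' s ≤ L * (l * E s + A * l ^ (-q)))
    (hYB : ∀ s ∈ Ioo 0 t, Y s ≤ B * (s / t) ^ (-δ)) (hYt : 0 ≤ Y t) :
    m t ≤ m 0 + L * (lam * β * B / (c * (β - δ)) + A * t * lam ^ (-q) / (1 - β * q)) := by
  have hβ : 0 < β := hδ.trans_lt hδβ
  have hβδ : 0 < β - δ := sub_pos.2 hδβ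
  have hq' : 0 < 1 - β * q := sub_pos.2 hβq
  have htm : t ∈ Icc 0 t := ⟨ht.le, le_rfl⟩
  have h0m : (0 : ℝ) ∈ Icc 0 t := ⟨le_rfl, ht.le⟩
  have hpc : ∀ e : ℝ, 0 < e → ContinuousOn (fun s : ℝ => (s / t) ^ e) (Icc 0 t) := fun e he =>
    ContinuousOn.rpow_const (by fun_prop) fun _ _ => Or.inr he.le
  have hpd : ∀ e : ℝ, ∀ s ∈ Ioo 0 t,
      HasDerivAt (fun s : ℝ => (s / t) ^ e) (1 / t * e * (s / t) ^ (e - 1)) s := fun e s hs =>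
    ((hasDerivAt_id s).div_const t).rpow_const (Or.inl (div_pos hs.1 ht).ne')
  have hf : AntitoneOn (fun s => m s + L / c * lam * ((s / t) ^ β * Y s) -
      L * (lam * β * B / (c * (β - δ)) * (s / t) ^ (β - δ) +
        A * t * lam ^ (-q) / (1 - β * q) * (s / t) ^ (1 - β * q))) (Icc 0 t) := by
    refine antitoneOn_Icc_of_hasDerivAt_nonpos
      (f' := fun s => m' s + L / c * lam * (1 / t * β * (s / t) ^ (β - 1) * Y s +
          (s / t) ^ β * -(c * E s)) -
        L * (lam * β * B / (c * (β - δ)) * (1 / t * (β - δ) * (s / t) ^ (β - δ - 1)) +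
          A * t * lam ^ (-q) / (1 - β * q) *
            (1 / t * (1 - β * q) * (s / t) ^ (1 - β * q - 1)))) ?_ ?_ ?_
    · exact (hmc.add (continuousOn_const.mul ((hpc β hβ).mul hYc))).sub
        (continuousOn_const.mul ((continuousOn_const.mul (hpc _ hβδ)).add
          (continuousOn_const.mul (hpc _ hq'))))
    · intro s hs
      exact ((hmd s hs).add (((hpd β s hs).mul (hYd s hs)).const_mul _)).sub
        ((((hpd (β - δ) s hs).const_mul _).add ((hpd (1 - β * q) s hs).const_mul _)).const_mul _)
    · intro s hs
      have hst : 0 < s / t := div_pos hs.1 ht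
      have h1 := hflux s hs (lam * (s / t) ^ β) (by positivity)
      rw [Real.mul_rpow hlam.le (by positivity), ← Real.rpow_mul hst.le] at h1
      have h2 : L / c * lam * (1 / t * β * (s / t) ^ (β - 1) * Y s) ≤
          L / c * lam * (1 / t * β * (s / t) ^ (β - 1) * (B * (s / t) ^ (-δ))) := by
        have := hYB s hs
        gcongr
      have e1 : (s / t) ^ (β - 1) * (B * (s / t) ^ (-δ)) = B * (s / t) ^ (β - δ - 1) := by
        rw [mul_left_comm, ← Real.rpow_add hst]; ring_nf
      rw [mul_assoc (1 / t * β) _ (B * _), e1] at h2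
      have e2 : lam * β * B / (c * (β - δ)) * (1 / t * (β - δ) * (s / t) ^ (β - δ - 1)) =
          1 / c * lam * (1 / t * β * (B * (s / t) ^ (β - δ - 1))) := by
        field_simp
      have e3 : A * t * lam ^ (-q) / (1 - β * q) *
          (1 / t * (1 - β * q) * (s / t) ^ (1 - β * q - 1)) =
          A * (lam ^ (-q) * (s / t) ^ (β * -q)) := by
        rw [show 1 - β * q - 1 = β * -q by ring]
        field_simp
        exact mul_div_cancel_right₀ A (by rw [mul_comm q]; exact hq'.ne')
      have e4 : L / c * lam * ((s / t) ^ β * -(c * E s)) = -(L * (lam * (s / t) ^ β * E s)) := by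
        field_simp
      rw [e2, e3, mul_add (L / c * lam), e4]
      have e5 : L * (1 / c * lam * (1 / t * β * (B * (s / t) ^ (β - δ - 1)))) =
          L / c * lam * (1 / t * β * (B * (s / t) ^ (β - δ - 1))) := by ring
      linarith
  have h1 := hf h0m htm ht.le
  simp only [zero_div, Real.zero_rpow hβ.ne', Real.zero_rpow hβδ.ne', Real.zero_rpow hq'.ne',
    div_self ht.ne', Real.one_rpow, mul_one, mul_zero, zero_mul, add_zero, sub_zero, one_mul] at h1
  have h2 : 0 ≤ L / c * lam * Y t := by positivity
  linarith

/-! ### Decay and the spread of mass -/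

noncomputable section

/-- The exponent `θ = (p - 2) / (p - 1)`: the decay of the sum of `u ^ (1 + θ)` controls the total
flow of mass. -/
def flowExponent (p : ℝ) : ℝ := (p - 2) / (p - 1)

/-- The growth exponent `a = p - 2 + p / N` of `psi p 1 Λ`. -/
def psiExponent (p N : ℝ) : ℝ := p - 2 + p / N

/-- The constant of the Nash inequality for the exponent `flowExponent p`. -/
def nashConst (p : ℝ) : ℝ :=
  (1 - 2 ^ (-((p + flowExponent p - 1) / p))) ^ (-p) * (flowExponent p)⁻¹

/-- The rate at which the Nash inequality makes a power of the sum of `u ^ (1 + θ)` grow. -/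
def decayRate (p N : ℝ) : ℝ :=
  (1 + flowExponent p) / (4 * nashConst p) * (psiExponent p N / flowExponent p)

/-- The constant in the decay estimate for the sum of `u ^ (1 + θ)`. -/
def decayConst (p N : ℝ) : ℝ :=
  2 * 2 ^ flowExponent p * max 1 (decayRate p N)⁻¹ ^ (flowExponent p / psiExponent p N)

/-- The exponent of the weight in time of the flux estimate, midway between the exponent
`θ / a` of the decay and `1 / (p - 1)`. -/
def timeExponent (p N : ℝ) : ℝ := (flowExponent p / psiExponent p N + 1 / (p - 1)) / 2

/-- The constant in the estimate for the spread of mass. -/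
def spreadConst (p N : ℝ) : ℝ :=
  timeExponent p N * decayConst p N / (flowExponent p * (1 + flowExponent p) *
    (timeExponent p N - flowExponent p / psiExponent p N)) +
  1 / (1 - timeExponent p N * (p - 1))

end

section Constants

variable {p N : ℝ}

lemma flowExponent_pos (hp : 2 < p) : 0 < flowExponent p := by
  unfold flowExponent; apply div_pos <;> linarith

lemma flowExponent_le_one (hp : 2 < p) : flowExponent p ≤ 1 := by
  unfold flowExponent; rw [div_le_one (by linarith)]; linarith

lemma psiExponent_pos (hp : 2 < p) (hN : 0 < N) : 0 < psiExponent p N := by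
  have : 0 < p / N := by positivity
  unfold psiExponent; linarith

lemma nashConst_pos (hp : 2 < p) : 0 < nashConst p := by
  have hθ := flowExponent_pos hp
  have h1 : 0 < (p + flowExponent p - 1) / p := by apply div_pos <;> linarith
  have : (2 : ℝ) ^ (-((p + flowExponent p - 1) / p)) < 1 :=
    Real.rpow_lt_one_of_one_lt_of_neg (by norm_num) (by linarith)
  have : 0 < 1 - (2 : ℝ) ^ (-((p + flowExponent p - 1) / p)) := by linarith
  unfold nashConst; positivity

lemma decayRate_pos (hp : 2 < p) (hN : 0 < N) : 0 < decayRate p N := by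
  have := flowExponent_pos hp
  have := psiExponent_pos hp hN
  have := nashConst_pos hp
  unfold decayRate; positivity

lemma decayConst_pos (hp : 2 < p) : 0 < decayConst p N := by
  have := flowExponent_pos hp
  have : 0 < max 1 (decayRate p N)⁻¹ := lt_max_of_lt_left one_pos
  unfold decayConst; positivity

lemma flowExponent_div_lt (hp : 2 < p) (hN : 0 < N) :
    flowExponent p / psiExponent p N < 1 / (p - 1) := by
  have ha := psiExponent_pos hp hN
  have : 0 < p / N := by positivity
  rw [flowExponent, div_div, div_lt_div_iff₀ (mul_pos (by linarith) ha) (by linarith),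
    psiExponent]
  nlinarith

lemma lt_timeExponent (hp : 2 < p) (hN : 0 < N) :
    flowExponent p / psiExponent p N < timeExponent p N := by
  have := flowExponent_div_lt hp hN
  unfold timeExponent; linarith

lemma timeExponent_mul_lt (hp : 2 < p) (hN : 0 < N) : timeExponent p N * (p - 1) < 1 := by
  have := flowExponent_div_lt hp hN
  rw [← lt_div_iff₀ (by linarith)]
  unfold timeExponent; linarith

lemma spreadConst_pos (hp : 2 < p) (hN : 0 < N) : 0 < spreadConst p N := by
  have hθ := flowExponent_pos hp
  have ha := psiExponent_pos hp hN
  have h1 := lt_timeExponent hp hN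
  have h2 := sub_pos.2 (timeExponent_mul_lt hp hN)
  have h3 : 0 < timeExponent p N := (div_pos hθ ha).trans h1
  have h4 := sub_pos.2 h1
  have h5 : 0 < decayConst p N := decayConst_pos hp
  unfold spreadConst; positivity

end Constants

namespace WeightedGraph

variable {V : Type*} {W : WeightedGraph V}

namespace IsDominated

variable {p N κ T K c : ℝ} {Λ : ℝ → ℝ} {u : ℝ → V → ℝ} {g : V → ℝ}

lemma tsum_rpow_pos (D : W.IsDominated p T K u g) [Infinite V] {θ : ℝ} (hθ : 0 < θ) {s : ℝ}
    (hs : s ∈ Icc 0 T) (hM : 0 < ∑' x, u s x * W.deg x) :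
    0 < ∑' x, u s x ^ (1 + θ) * W.deg x := by
  obtain ⟨x, hx⟩ : ∃ x, 0 < u s x := by
    by_contra! h
    have h0 : ∀ x, u s x = 0 := fun x => le_antisymm (h x) (D.nonneg s hs x)
    simp [h0] at hM
  refine (D.summable_rpow_one_add hθ hs).tsum_pos (fun y => ?_) x
    (mul_pos (Real.rpow_pos_of_pos hx _) (W.deg_pos x))
  exact mul_nonneg (Real.rpow_nonneg (D.nonneg s hs y) _) (W.deg_nonneg y)

/-- Decay of the sum of `u ^ (1 + θ)`. The quantity `w = Y ^ (1 / θ)`, suitably normalized, plays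
the role of the supremum of `u / M`; the Nash inequality at the level `k = M w`, where the low
part is half of the sum, gives a differential inequality for it. -/
lemma tsum_rpow_le [Infinite V] (D : W.IsDominated p T K u g) (hp : 2 < p) (hN : 0 < N)
    (hΛ : IsFaberKrahnFunction p N κ Λ) (hFK : W.FaberKrahn p Λ) (hc : 0 < c)
    (hdeg : ∀ x, c ≤ W.deg x) {M : ℝ} (hM : 0 < M) (hM0 : ∑' x, u 0 x * W.deg x = M) {s t : ℝ}
    (hs : 0 < s) (hst : s ≤ t) (htT : t ≤ T) :
    ∑' x, u s x ^ (1 + flowExponent p) * W.deg x ≤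
      decayConst p N * M * (M * psiInv p 1 Λ (t⁻¹ * M ^ (-(p - 2)))) ^ flowExponent p *
        (s / t) ^ (-(flowExponent p / psiExponent p N)) := by
  set θ := flowExponent p with hθdef
  set a := psiExponent p N with hadef
  have hθ : 0 < θ := flowExponent_pos hp
  have hθ1 : θ ≤ 1 := flowExponent_le_one hp
  have ha : 0 < a := psiExponent_pos hp hN
  have hC : 0 < nashConst p := nashConst_pos hp
  have hr : 0 < decayRate p N := decayRate_pos hp hN
  have ht : 0 < t := hs.trans_le hst
  have hsub : Icc 0 s ⊆ Icc 0 T := Icc_subset_Icc_right (hst.trans htT)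
  have hsub' : Ioo 0 s ⊆ Ioo 0 T := Ioo_subset_Ioo_right (hst.trans htT)
  have hmass : ∀ τ ∈ Icc 0 T, ∑' x, u τ x * W.deg x = M := fun τ hτ =>
    (D.mass_eq hp hτ).trans hM0
  set Y : ℝ → ℝ := fun τ => ∑' x, u τ x ^ (1 + θ) * W.deg x with hY
  have hY0 : ∀ τ ∈ Icc 0 T, 0 < Y τ := fun τ hτ =>
    D.tsum_rpow_pos hθ hτ (by rw [hmass τ hτ]; exact hM)
  set A := (2 * M)⁻¹ * (2 * M) ^ (-(1 / θ)) with hA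
  have hA0 : 0 < A := by positivity
  have hlevel : ∀ y : ℝ, 0 < y → (2 * (M * (A * y ^ (1 / θ)))) ^ θ = y / (2 * M) := by
    intro y hy
    have e1 : 2 * (M * (A * y ^ (1 / θ))) = (2 * M) ^ (-(1 / θ)) * y ^ (1 / θ) := by
      rw [hA]; field_simp
    rw [e1, Real.mul_rpow (by positivity) (by positivity), ← Real.rpow_mul (by positivity),
      ← Real.rpow_mul hy.le, neg_mul, one_div_mul_cancel hθ.ne', Real.rpow_neg_one, Real.rpow_one]
    ring
  set C := (1 + θ) / (4 * nashConst p) with hCdef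
  have hode : ∀ τ ∈ Ioo 0 s, -((1 + θ) / 2 * W.dissipation p θ (u τ)) ≤
      -(C * M ^ (p - 2) * Y τ * psi p 1 Λ (A * Y τ ^ (1 / θ))) := by
    intro τ hτ
    have hτ' := Ioo_subset_Icc_self (hsub' hτ)
    have hy := hY0 τ hτ'
    set w := A * Y τ ^ (1 / θ) with hw
    have hw0 : 0 < w := by positivity
    have hn := nash_inequality hp hθ hθ1 hΛ hFK hc hdeg (D.nonneg τ hτ') (D.summable_mass hτ')
      (D.summable_rpow_one_add hθ hτ') (D.summable_dissipation hp hθ hτ') (k := M * w)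
      (by positivity) (by rw [hmass τ hτ']; exact hM)
    rw [hmass τ hτ', hlevel _ hy] at hn
    have e1 : M / (M * w) = w⁻¹ := by field_simp
    have e2 : (1 - 2 ^ (-((p + θ - 1) / p))) ^ (-p) * θ⁻¹ = nashConst p := rfl
    have e3 : Y τ / (2 * M) * M = Y τ / 2 := by field_simp
    have hΛw := hΛ.pos w⁻¹ (by positivity)
    have e4 : (M * w) ^ (2 - p) * (Λ w⁻¹)⁻¹ = (M ^ (p - 2) * psi p 1 Λ w)⁻¹ := by
      rw [psi_one_eq, show (2 - p : ℝ) = -(p - 2) by ring, Real.rpow_neg (by positivity),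
        Real.mul_rpow hM.le hw0.le, ← mul_inv, mul_assoc]
    rw [e1, e2, e3, e4] at hn
    change Y τ ≤ _ at hn
    have hψ := psi_one_pos hΛ hw0
    have h1 : Y τ / 2 * (M ^ (p - 2) * psi p 1 Λ w) ≤ nashConst p * W.dissipation p θ (u τ) := by
      have h2 : Y τ / 2 ≤ nashConst p * W.dissipation p θ (u τ) / (M ^ (p - 2) * psi p 1 Λ w) := by
        have e5 : nashConst p * W.dissipation p θ (u τ) / (M ^ (p - 2) * psi p 1 Λ w) =
            nashConst p * ((M ^ (p - 2) * psi p 1 Λ w)⁻¹ * W.dissipation p θ (u τ)) := by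
          rw [div_eq_mul_inv]; ring
        linarith
      rwa [le_div_iff₀ (by positivity)] at h2
    rw [neg_le_neg_iff]
    calc C * M ^ (p - 2) * Y τ * psi p 1 Λ w
        = (1 + θ) / (2 * nashConst p) * (Y τ / 2 * (M ^ (p - 2) * psi p 1 Λ w)) := by
          rw [hCdef]; field_simp; ring
      _ ≤ (1 + θ) / (2 * nashConst p) * (nashConst p * W.dissipation p θ (u τ)) := by gcongr
      _ = _ := by field_simp
  have hmain := mul_le_one_of_deriv_le (Y := Y) (ψ := psi p 1 Λ) (a := a) (θ := θ) hs
    (by positivity : 0 ≤ C * M ^ (p - 2)) ha hθ hA0 (fun r => psi_one_pos hΛ)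
    (fun r q hr hrq => psi_div_rpow_mono hΛ hr hrq)
    ((D.continuousOn_tsum_rpow_one_add hθ).mono hsub) (fun τ hτ => hY0 τ (hsub hτ))
    (fun τ hτ => D.hasDerivAt_tsum_rpow_one_add hp hθ (hsub' hτ)) hode
  have hy := hY0 s ⟨hs.le, hst.trans htT⟩
  set w := A * Y s ^ (1 / θ) with hw
  have hw0 : 0 < w := by positivity
  set z := t⁻¹ * M ^ (-(p - 2)) with hz
  have hz0 : 0 < z := by positivity
  obtain ⟨hP0, hP⟩ := psiInv_spec hp hN hΛ hz0
  set P := psiInv p 1 Λ z with hPdef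
  set C1 := max 1 (decayRate p N)⁻¹ with hC1
  have hC10 : 1 ≤ C1 := le_max_left _ _
  have hts : 1 ≤ t / s := (one_le_div hs).2 hst
  have hψw : psi p 1 Λ w ≤ C1 * (t / s) * psi p 1 Λ P := by
    have h1 : decayRate p N * (M ^ (p - 2) * s) * psi p 1 Λ w ≤ 1 := by
      calc _ = C * M ^ (p - 2) * (a / θ) * s * psi p 1 Λ w := by
            rw [decayRate, ← hθdef, ← hadef, hCdef]; ring
        _ ≤ 1 := hmain
    have h2 : psi p 1 Λ w ≤ (decayRate p N)⁻¹ * (M ^ (p - 2) * s)⁻¹ := by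
      rw [← mul_inv, ← one_div, le_div_iff₀ (by positivity), mul_comm]
      exact h1
    refine h2.trans ?_
    have e : (M ^ (p - 2) * s)⁻¹ = t / s * psi p 1 Λ P := by
      rw [hP, hz, Real.rpow_neg hM.le]; field_simp
    rw [e, ← mul_assoc]
    have hψP := psi_one_pos hΛ hP0
    gcongr
    exact le_max_right _ _
  have hwP : w ≤ P * (C1 * (t / s)) ^ (1 / a) :=
    le_mul_of_psi_le hp hN hΛ hw0 hP0 (one_le_mul_of_one_le_of_one_le hC10 hts) hψw
  have hYw : Y s = 2 * M * (2 * (M * w)) ^ θ := by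
    rw [hlevel _ hy]; field_simp
  change Y s ≤ _
  rw [hYw]
  calc 2 * M * (2 * (M * w)) ^ θ
      ≤ 2 * M * (2 * (M * (P * (C1 * (t / s)) ^ (1 / a)))) ^ θ := by gcongr
    _ = _ := by
      have e1 : 2 * (M * (P * (C1 * (t / s)) ^ (1 / a))) =
          2 * (M * P) * (C1 * (t / s)) ^ (1 / a) := by ring
      have e2 : (s / t) ^ (-(θ / a)) = (t / s) ^ (θ / a) := by
        rw [Real.rpow_neg (by positivity), ← Real.inv_rpow (by positivity), inv_div]
      have e3 : ((C1 * (t / s)) ^ (1 / a)) ^ θ = C1 ^ (θ / a) * (t / s) ^ (θ / a) := by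
        rw [← Real.rpow_mul (by positivity), one_div_mul_eq_div,
          Real.mul_rpow (by positivity) (by positivity)]
      rw [e1, e2, Real.mul_rpow (by positivity) (by positivity), e3,
        Real.mul_rpow (by norm_num) (by positivity), decayConst, ← hθdef, ← hadef, ← hC1]
      ring

/-- The total flow is controlled by the dissipation and the mass. -/
lemma tsum_abs_flow_le (D : W.IsDominated p T K u g) (hp : 2 < p) {s l : ℝ} (hs : s ∈ Icc 0 T)
    (hl : 0 < l) :
    ∑' z, |W.flow p (u s) z| ≤ l * (flowExponent p)⁻¹ * W.dissipation p (flowExponent p) (u s) +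
      l ^ (-(p - 1)) * (2 * ∑' x, u s x * W.deg x) := by
  have h1 := (D.summable_dissipation hp (flowExponent_pos hp) hs).mul_left
    (l * (flowExponent p)⁻¹)
  have h2 := (W.summable_edge_add (D.nonneg s hs) (D.summable_mass hs)).mul_left (l ^ (-(p - 1)))
  have h3 := (D.summable_flow hp hs).abs.tsum_le_tsum (fun z => ?_) (h1.add h2)
  · rwa [h1.tsum_add h2, tsum_mul_left, tsum_mul_left,
      W.tsum_edge_add (D.nonneg s hs) (D.summable_mass hs)] at h3
  · have h := mul_le_mul_of_nonneg_right
      (abs_sub_rpow_le_dissipation (D.nonneg s hs z.1) (D.nonneg s hs z.2) hp hl)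
      (W.weight_nonneg z.1 z.2)
    rw [W.abs_flow hp, dissipationDensity]
    refine h.trans (le_of_eq ?_)
    rw [flowExponent]
    ring

/-- The spread of mass: against a function `φ` with increments at most `L` along the edges, the
mass moves in time `t` by at most `L` times the total mass times the critical radius. -/
lemma tsum_mul_le_add [Infinite V] (D : W.IsDominated p T K u g) (hp : 2 < p) (hN : 0 < N)
    (hΛ : IsFaberKrahnFunction p N κ Λ) (hFK : W.FaberKrahn p Λ) (hc : 0 < c)
    (hdeg : ∀ x, c ≤ W.deg x) {M : ℝ} (hM : 0 < M) (hM0 : ∑' x, u 0 x * W.deg x = M) {t : ℝ}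
    (ht : 0 < t) (htT : t ≤ T) {φ : V → ℝ} {B L : ℝ} (hB : ∀ x, |φ x| ≤ B) (hL : 0 ≤ L)
    (hφ : ∀ x y, W.graph.Adj x y → |φ y - φ x| ≤ L) :
    ∑' x, u t x * φ x * W.deg x ≤ ∑' x, u 0 x * φ x * W.deg x +
      L * (spreadConst p N * M * criticalRadius p Λ M t) := by
  set θ := flowExponent p with hθdef
  set a := psiExponent p N with hadef
  have hθ : 0 < θ := flowExponent_pos hp
  have ha : 0 < a := psiExponent_pos hp hN
  have hp0 : 0 < p := by linarith
  have hp1 : 0 < p - 1 := by linarith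
  have hz0 : 0 < t⁻¹ * M ^ (-(p - 2)) := by positivity
  have hP0 := (psiInv_spec hp hN hΛ hz0).1
  set P := psiInv p 1 Λ (t⁻¹ * M ^ (-(p - 2))) with hP
  have hsub : Icc 0 t ⊆ Icc 0 T := Icc_subset_Icc_right htT
  have hsub' : Ioo 0 t ⊆ Ioo 0 T := Ioo_subset_Ioo_right htT
  -- The choice of `λ₀` that balances the two terms of the flux estimate.
  set lam := t ^ (1 / p) * (M * P) ^ (-(θ / p)) with hlam
  have hlam0 : 0 < lam := by positivity
  have hflux : ∀ s ∈ Ioo 0 t, ∀ l, 0 < l →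
      -(1 / 2) * ∑' z : V × V, (φ z.2 - φ z.1) * W.flow p (u s) z ≤
        L * (l * (W.dissipation p θ (u s) / (2 * θ)) + M * l ^ (-(p - 1))) := by
    intro s hs l hl
    have hs' := hsub (Ioo_subset_Icc_self hs)
    have hbd : ∀ z : V × V, ‖(φ z.2 - φ z.1) * W.flow p (u s) z‖ ≤ L * |W.flow p (u s) z| := by
      intro z
      rw [norm_mul, Real.norm_eq_abs, Real.norm_eq_abs]
      by_cases hz : W.graph.Adj z.1 z.2
      · exact mul_le_mul_of_nonneg_right (hφ _ _ hz) (abs_nonneg _)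
      · simp [flow, W.weight_eq_zero_of_not_adj hz]
    have h1 := tsum_of_norm_bounded ((D.summable_flow hp hs').abs.mul_left L).hasSum hbd
    rw [tsum_mul_left] at h1
    have h2 := D.tsum_abs_flow_le hp hs' hl
    rw [(D.mass_eq hp hs').trans hM0] at h2
    have h3 := neg_le_of_abs_le h1
    have h4 := mul_le_mul_of_nonneg_left h2 hL
    have e : l * (W.dissipation p θ (u s) / (2 * θ)) =
      l * θ⁻¹ * W.dissipation p θ (u s) / 2 := by field_simp
    rw [e]
    linarith
  have hYd : ∀ s ∈ Ioo 0 t, HasDerivAt (fun s => ∑' x, u s x ^ (1 + θ) * W.deg x)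
      (-(θ * (1 + θ) * (W.dissipation p θ (u s) / (2 * θ)))) s := fun s hs => by
    refine (D.hasDerivAt_tsum_rpow_one_add hp hθ (hsub' hs)).congr_deriv ?_
    field_simp
  have hYt : 0 ≤ ∑' x, u t x ^ (1 + θ) * W.deg x := tsum_nonneg fun x =>
    mul_nonneg (Real.rpow_nonneg (D.nonneg t ⟨ht.le, htT⟩ x) _) (W.deg_nonneg x)
  have hmain := le_add_of_flux_le (q := p - 1) (β := timeExponent p N) (δ := θ / a) ht hL hlam0
    (by positivity : 0 < θ * (1 + θ)) (by positivity) (lt_timeExponent hp hN)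
    (timeExponent_mul_lt hp hN) ((D.continuousOn_tsum_mul hB).mono hsub)
    ((D.continuousOn_tsum_rpow_one_add hθ).mono hsub)
    (fun s hs => D.hasDerivAt_tsum_mul hp hB (hsub' hs)) hYd hflux
    (fun s hs => D.tsum_rpow_le hp hN hΛ hFK hc hdeg hM hM0 hs.1 hs.2.le htT) hYt
  refine hmain.trans (le_of_eq ?_)
  have hS : 0 < M * P := by positivity
  have eρ : criticalRadius p Λ M t = t ^ (1 / p) * (M * P) ^ ((p - 2) / p) := by
    rw [criticalRadius, ← hP, Real.mul_rpow hM.le hP0.le, mul_assoc]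
  have hθp : θ * (p - 1) = p - 2 := by rw [hθdef, flowExponent]; field_simp
  have e1 : lam * (M * P) ^ θ = criticalRadius p Λ M t := by
    rw [eρ, hlam, mul_assoc, ← Real.rpow_add hS, ← hθp]
    congr 2; field_simp; ring
  have e2 : t * lam ^ (-(p - 1)) = criticalRadius p Λ M t := by
    rw [eρ, hlam, Real.mul_rpow (by positivity) (by positivity), ← Real.rpow_mul ht.le,
      ← Real.rpow_mul hS.le, ← mul_assoc, ← hθp]
    congr 1
    · nth_rw 1 [← Real.rpow_one t]
      rw [← Real.rpow_add ht]
      congr 1; field_simp; ring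
    · congr 1; field_simp
  rw [spreadConst, ← hθdef, ← hadef]
  congr 2
  calc _ = timeExponent p N * decayConst p N / (θ * (1 + θ) * (timeExponent p N - θ / a)) * M *
        (lam * (M * P) ^ θ) + 1 / (1 - timeExponent p N * (p - 1)) * M *
        (t * lam ^ (-(p - 1))) := by ring
    _ = _ := by rw [e1, e2]; ring

end IsDominated

/-! ### Test functions of the distance -/

lemma abs_dist_sub_dist_le {x y : V} (x₀ : V) (h : W.graph.Adj x y) :
    |(W.graph.dist y x₀ : ℝ) - W.graph.dist x x₀| ≤ 1 := by
  have h1 : W.graph.dist x x₀ ≤ W.graph.dist x y + W.graph.dist y x₀ := W.connected.dist_triangle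
  have h2 : W.graph.dist y x₀ ≤ W.graph.dist y x + W.graph.dist x x₀ := W.connected.dist_triangle
  rw [SimpleGraph.dist_eq_one_iff_adj.2 h] at h1
  rw [SimpleGraph.dist_eq_one_iff_adj.2 h.symm] at h2
  have h1' : (W.graph.dist x x₀ : ℝ) ≤ 1 + W.graph.dist y x₀ := by exact_mod_cast h1
  have h2' : (W.graph.dist y x₀ : ℝ) ≤ 1 + W.graph.dist x x₀ := by exact_mod_cast h2
  rw [abs_le]; constructor <;> linarith

lemma lqNorm_one (U : Set V) {f : V → ℝ} (hf : ∀ x, 0 ≤ f x) :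
    W.lqNorm 1 U f = ∑' x : U, f x * W.deg x := by
  simp [lqNorm, abs_of_nonneg (hf _)]

/-- The cutoff function `min 1 (2 (R - d) / R)₊` of the ball of radius `R`. -/
noncomputable def cutoff (W : WeightedGraph V) (x₀ : V) (R : ℕ) (x : V) : ℝ :=
  max 0 (min 1 (2 / R * (R - W.graph.dist x x₀)))

lemma abs_cutoff_sub_le {x y x₀ : V} {R : ℕ} (h : W.graph.Adj x y) :
    |W.cutoff x₀ R y - W.cutoff x₀ R x| ≤ 2 / R := by
  refine (abs_max_sub_max_le_max _ _ _ _).trans ?_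
  rw [sub_self, abs_zero]
  refine max_le (by positivity) ((abs_min_sub_min_le_max _ _ _ _).trans ?_)
  rw [sub_self, abs_zero]
  refine max_le (by positivity) ?_
  rw [← mul_sub, abs_mul, abs_of_nonneg (by positivity : (0 : ℝ) ≤ 2 / R), abs_sub_comm,
    sub_sub_sub_cancel_left, abs_sub_comm, abs_sub_comm]
  exact mul_le_of_le_one_right (by positivity) (abs_dist_sub_dist_le x₀ h)

lemma abs_rpow_dist_sub_le {x y x₀ : V} {R : ℕ} (hR : 0 < R) {α : ℝ} (hα : 0 < α) (hα1 : α ≤ 1)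
    (h : W.graph.Adj x y) :
    |((R : ℝ) + W.graph.dist y x₀) ^ α - ((R : ℝ) + W.graph.dist x x₀) ^ α| ≤
      (R : ℝ) ^ (α - 1) := by
  wlog hxy : W.graph.dist x x₀ ≤ W.graph.dist y x₀ generalizing x y
  · rw [abs_sub_comm]; exact this h.symm (le_of_not_ge hxy)
  have hR' : (0 : ℝ) < R := by exact_mod_cast hR
  have hxy' : (R : ℝ) + W.graph.dist x x₀ ≤ R + W.graph.dist y x₀ := by gcongr
  rw [abs_of_nonneg (sub_nonneg.2 (Real.rpow_le_rpow (by positivity) hxy' hα.le))]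
  refine (rpow_sub_rpow_le (by positivity) hxy' (by positivity) hα1).trans ?_
  have h1 : ((R : ℝ) + W.graph.dist y x₀) ^ (α - 1) ≤ (R : ℝ) ^ (α - 1) :=
    Real.rpow_le_rpow_of_nonpos hR' (by simp) (by linarith)
  have h2 := (abs_le.1 (abs_dist_sub_dist_le x₀ h)).2
  calc _ ≤ (R : ℝ) ^ (α - 1) * 1 := by
        refine mul_le_mul h1 (by linarith) (by linarith) (by positivity)
    _ = _ := mul_one _

end WeightedGraph

namespace WeightedGraph

variable {V : Type*} {W : WeightedGraph V}

namespace IsDominated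

variable {p N κ T K c : ℝ} {Λ : ℝ → ℝ} {u : ℝ → V → ℝ} {g : V → ℝ}

/-- The mass inside the ball of radius `R`, by the cutoff function of the ball. -/
lemma mass_le_tsum_ball_add [Infinite V] (D : W.IsDominated p T K u g) (hp : 2 < p) (hN : 0 < N)
    (hΛ : IsFaberKrahnFunction p N κ Λ) (hFK : W.FaberKrahn p Λ) (hc : 0 < c)
    (hdeg : ∀ x, c ≤ W.deg x) {M : ℝ} (hM : 0 < M) (hM0 : ∑' x, u 0 x * W.deg x = M) {t : ℝ}
    (ht : 0 < t) (htT : t ≤ T) {x₀ : V} {R : ℕ} (hR : 0 < R)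
    (hsupp : Function.support (u 0) ⊆ W.ball x₀ (R / 2)) :
    M ≤ ∑' x : W.ball x₀ R, u t x * W.deg x +
      2 / R * (spreadConst p N * M * criticalRadius p Λ M t) := by
  have htm : t ∈ Icc 0 T := ⟨ht.le, htT⟩
  have hR' : (0 : ℝ) < R := by exact_mod_cast hR
  have hcut0 : ∀ x, 0 ≤ W.cutoff x₀ R x := fun x => le_max_left _ _
  have hcut1 : ∀ x, W.cutoff x₀ R x ≤ 1 := fun x => max_le zero_le_one (min_le_left _ _)
  have hB : ∀ x, |-W.cutoff x₀ R x| ≤ 1 := fun x => by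
    rw [abs_neg, abs_of_nonneg (hcut0 x)]; exact hcut1 x
  have hB' : ∀ x, |W.cutoff x₀ R x| ≤ 1 := fun x => by simpa using hB x
  have h := D.tsum_mul_le_add hp hN hΛ hFK hc hdeg hM hM0 ht htT hB
    (by positivity : (0 : ℝ) ≤ 2 / R) (fun x y hxy => by
      rw [neg_sub_neg, abs_sub_comm]; exact abs_cutoff_sub_le hxy)
  have hinit : ∑' x, u 0 x * -W.cutoff x₀ R x * W.deg x = -M := by
    rw [← hM0, ← tsum_neg]
    refine tsum_congr fun x => ?_
    by_cases hx : u 0 x = 0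
    · simp [hx]
    · have hd : W.graph.dist x x₀ ≤ R / 2 := hsupp hx
      have hd' : (2 * W.graph.dist x x₀ : ℝ) ≤ R := by
        have : 2 * W.graph.dist x x₀ ≤ R := by omega
        exact_mod_cast this
      have h1 : 1 ≤ 2 / (R : ℝ) * (R - W.graph.dist x x₀) := by
        rw [div_mul_eq_mul_div, le_div_iff₀ hR']; linarith
      rw [cutoff, min_eq_left h1, max_eq_right zero_le_one]
      ring
  have hball : ∑' x, u t x * W.cutoff x₀ R x * W.deg x ≤
      ∑' x : W.ball x₀ R, u t x * W.deg x := by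
    rw [tsum_subtype (W.ball x₀ R) fun x => u t x * W.deg x]
    refine (D.summable_mul hB' htm).tsum_le_tsum (fun x => ?_)
      ((D.summable_mass htm).indicator _)
    have h0 := D.nonneg t htm x
    have hd := W.deg_nonneg x
    by_cases hx : x ∈ W.ball x₀ R
    · rw [indicator_of_mem hx]
      refine mul_le_mul_of_nonneg_right ?_ hd
      exact mul_le_of_le_one_right h0 (hcut1 x)
    · rw [indicator_of_notMem hx]
      have hx' : (R : ℝ) ≤ W.graph.dist x x₀ := by
        have : R < W.graph.dist x x₀ := not_le.1 hx
        exact_mod_cast this.le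
      have h1 : 2 / (R : ℝ) * (R - W.graph.dist x x₀) ≤ 0 :=
        mul_nonpos_of_nonneg_of_nonpos (by positivity) (by linarith)
      rw [cutoff, max_eq_left ((min_le_right _ _).trans h1)]
      simp
  have hneg : ∑' x, u t x * -W.cutoff x₀ R x * W.deg x =
      -∑' x, u t x * W.cutoff x₀ R x * W.deg x := by
    rw [← tsum_neg]; exact tsum_congr fun x => by ring
  linarith

/-- The moments, tested with the truncations of `(R + d) ^ α`, whose increments are at most
`R ^ (α - 1)`; this makes the bound uniform in `α`. -/
lemma sum_moment_le [Infinite V] (D : W.IsDominated p T K u g) (hp : 2 < p) (hN : 0 < N)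
    (hΛ : IsFaberKrahnFunction p N κ Λ) (hFK : W.FaberKrahn p Λ) (hc : 0 < c)
    (hdeg : ∀ x, c ≤ W.deg x) {M : ℝ} (hM : 0 < M) (hM0 : ∑' x, u 0 x * W.deg x = M) {t : ℝ}
    (ht : 0 < t) (htT : t ≤ T) {x₀ : V} {R : ℕ} (hR : 0 < R)
    (hsupp : Function.support (u 0) ⊆ W.ball x₀ (R / 2)) {α : ℝ} (hα : 0 < α) (hα1 : α ≤ 1)
    (F : Finset V) :
    ∑ x ∈ F, (W.graph.dist x x₀ : ℝ) ^ α * u t x * W.deg x ≤ 2 * (R : ℝ) ^ α * M +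
      (R : ℝ) ^ (α - 1) * (spreadConst p N * M * criticalRadius p Λ M t) := by
  have htm : t ∈ Icc 0 T := ⟨ht.le, htT⟩
  have h0m : (0 : ℝ) ∈ Icc 0 T := ⟨le_rfl, ht.le.trans htT⟩
  have hR' : (0 : ℝ) < R := by exact_mod_cast hR
  set ξ : V → ℝ := fun x => ((R : ℝ) + W.graph.dist x x₀) ^ α with hξ
  have hξ0 : ∀ x, 0 ≤ ξ x := fun x => by positivity
  set n := ∑ x ∈ F, ξ x with hn
  have hn0 : 0 ≤ n := Finset.sum_nonneg fun x _ => hξ0 x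
  have hφ0 : ∀ x, 0 ≤ min (ξ x) n := fun x => le_min (hξ0 x) hn0
  have hB : ∀ x, |min (ξ x) n| ≤ n := fun x => by
    rw [abs_of_nonneg (hφ0 x)]; exact min_le_right _ _
  have h := D.tsum_mul_le_add hp hN hΛ hFK hc hdeg hM hM0 ht htT hB
    (by positivity : (0 : ℝ) ≤ (R : ℝ) ^ (α - 1)) (fun x y hxy => by
      refine (abs_min_sub_min_le_max _ _ _ _).trans ?_
      rw [sub_self, abs_zero]
      exact max_le (abs_rpow_dist_sub_le hR hα hα1 hxy) (by positivity))
  have hinit : ∑' x, u 0 x * min (ξ x) n * W.deg x ≤ 2 * (R : ℝ) ^ α * M := by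
    rw [← hM0, ← tsum_mul_left]
    refine (D.summable_mul hB h0m).tsum_le_tsum (fun x => ?_) ((D.summable_mass h0m).mul_left _)
    have h0 := D.nonneg 0 h0m x
    have hd := W.deg_nonneg x
    by_cases hx : u 0 x = 0
    · simp [hx]
    · have hdx : W.graph.dist x x₀ ≤ R / 2 := hsupp hx
      have hdx' : (W.graph.dist x x₀ : ℝ) ≤ R := by
        exact_mod_cast hdx.trans (Nat.div_le_self R 2)
      have h1 : ξ x ≤ 2 * (R : ℝ) ^ α := by
        calc ξ x ≤ (2 * (R : ℝ)) ^ α := by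
              refine Real.rpow_le_rpow (by positivity) (by linarith) hα.le
          _ = 2 ^ α * (R : ℝ) ^ α := Real.mul_rpow (by norm_num) hR'.le
          _ ≤ 2 * (R : ℝ) ^ α := by
              gcongr
              simpa using Real.rpow_le_rpow_of_exponent_le (one_le_two : (1 : ℝ) ≤ 2) hα1
      have h2 := (min_le_left (ξ x) n).trans h1
      calc u 0 x * min (ξ x) n * W.deg x ≤ u 0 x * (2 * (R : ℝ) ^ α) * W.deg x := by gcongr
        _ = _ := by ring
  refine le_trans ?_ (h.trans (add_le_add hinit le_rfl))
  refine le_trans (Finset.sum_le_sum fun x hx => ?_) ((D.summable_mul hB htm).sum_le_tsum F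
    fun x _ => mul_nonneg (mul_nonneg (D.nonneg t htm x) (hφ0 x)) (W.deg_nonneg x))
  have h0 := D.nonneg t htm x
  have hd := W.deg_nonneg x
  have h1 : (W.graph.dist x x₀ : ℝ) ^ α ≤ min (ξ x) n := by
    refine le_trans ?_ (le_min le_rfl (Finset.single_le_sum (fun y _ => hξ0 y) hx))
    exact Real.rpow_le_rpow (by positivity) (by linarith) hα.le
  rw [mul_comm (u t x)]
  gcongr

end IsDominated

end WeightedGraph

theorem theorem1p5 (p N κ : ℝ) (hp : 2 < p) (hN : 0 < N) (hκ : 0 < κ) :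
    ∃ (Γ : ℝ → ℝ) (γ : ℝ), (∀ ε : ℝ, 0 < ε → ε < 1 → 0 < Γ ε) ∧ 0 < γ ∧
      ∀ (V : Type*) [Infinite V] (W : WeightedGraph V) (Λ : ℝ → ℝ),
        IsFaberKrahnFunction p N κ Λ → W.FaberKrahn p Λ →
        ∀ (x₀ : V) (u₀ : V → ℝ), (∀ x, 0 ≤ u₀ x) → (Function.support u₀).Finite →
        ∀ (r T : ℝ) (u : ℝ → V → ℝ), 1 ≤ r → W.IsSolution p r T u₀ u →
          (∀ t ∈ Set.Icc 0 T, ∀ x, 0 ≤ u t x) →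
        ∀ t : ℝ, 0 < t → t < T → ∀ R : ℕ, Function.support u₀ ⊆ W.ball x₀ (R / 2) →
          (∀ ε : ℝ, 0 < ε → ε < 1 →
            Γ ε * criticalRadius p Λ (W.lqNorm 1 Set.univ u₀) t ≤ R →
            8 ≤ Γ ε * criticalRadius p Λ (W.lqNorm 1 Set.univ u₀) t →
            (1 - ε) * W.lqNorm 1 Set.univ u₀ ≤ W.lqNorm 1 (W.ball x₀ R) (u t)) ∧
          (Γ (1 / 2) * criticalRadius p Λ (W.lqNorm 1 Set.univ u₀) t ≤ R →
            8 ≤ Γ (1 / 2) * criticalRadius p Λ (W.lqNorm 1 Set.univ u₀) t →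
            ∀ α : ℝ, 0 < α → α < 1 →
              Summable (fun x => (W.graph.dist x x₀ : ℝ) ^ α * u t x * W.deg x) ∧
              ∑' x, (W.graph.dist x x₀ : ℝ) ^ α * u t x * W.deg x ≤
                γ * (R : ℝ) ^ α * W.lqNorm 1 Set.univ u₀) := by
  have hC : 0 < spreadConst p N := spreadConst_pos hp hN
  refine ⟨fun ε => 2 * spreadConst p N / ε, 3, fun ε hε _ => by positivity, by norm_num, ?_⟩
  intro V _ W Λ hΛ hFK x₀ u₀ hu₀ hfin r T u hr hsol hu t ht htT R hsupp
  have hT : 0 < T := ht.trans htT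
  obtain ⟨c, hc, hdeg⟩ := W.exists_deg_lower_bound (by linarith) hN hΛ hFK
  obtain ⟨K, g, D⟩ := hsol.exists_isDominated hp hr hT hc hdeg hu hfin
  have hu0 : u 0 = u₀ := funext hsol.initial
  set M := W.lqNorm 1 Set.univ u₀ with hMdef
  set ρ := criticalRadius p Λ M t with hρ
  have hM0 : ∑' x, u 0 x * W.deg x = M := by
    rw [hMdef, WeightedGraph.lqNorm_one _ hu₀, tsum_univ fun x => u₀ x * W.deg x, hu0]
  have hMnn : 0 ≤ M := hM0 ▸ tsum_nonneg fun x =>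
    mul_nonneg (D.nonneg 0 ⟨le_rfl, hT.le⟩ x) (W.deg_nonneg x)
  -- The critical radius of the zero mass is zero, so that `8 ≤ Γ ε * ρ` excludes it.
  have hMpos : ∀ G : ℝ, 8 ≤ G * ρ → 0 < M := by
    intro G h8
    refine hMnn.lt_of_ne fun h => ?_
    have hq : (p - 2) / p ≠ 0 := (div_pos (by linarith) (by linarith)).ne'
    rw [hρ, criticalRadius, ← h, Real.zero_rpow hq] at h8
    norm_num at h8
  have hRpos : ∀ G : ℝ, G * ρ ≤ R → 8 ≤ G * ρ → 0 < R := by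
    intro G h1 h8
    have : (0 : ℝ) < R := by linarith
    exact_mod_cast this
  rw [← hu0] at hsupp
  refine ⟨fun ε hε _ h1 h8 => ?_, fun h1 h8 α hα hα1 => ?_⟩
  · have hM := hMpos _ h8
    have hR := hRpos _ h1 h8
    have hR' : (0 : ℝ) < R := by exact_mod_cast hR
    have h := D.mass_le_tsum_ball_add hp hN hΛ hFK hc hdeg hM hM0 ht htT.le hR hsupp
    rw [WeightedGraph.lqNorm_one _ (D.nonneg t ⟨ht.le, htT.le⟩)]
    have h2 : 2 / R * (spreadConst p N * M * ρ) ≤ ε * M := by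
      rw [div_mul_eq_mul_div, div_le_iff₀ hε] at h1
      rw [div_mul_eq_mul_div, div_le_iff₀ hR']
      calc 2 * (spreadConst p N * M * ρ) = 2 * spreadConst p N * ρ * M := by ring
        _ ≤ R * ε * M := by gcongr
        _ = _ := by ring
    linarith
  · have hM := hMpos _ h8
    have hR := hRpos _ h1 h8
    have hR' : (0 : ℝ) < R := by exact_mod_cast hR
    have h := D.sum_moment_le hp hN hΛ hFK hc hdeg hM hM0 ht htT.le hR hsupp hα hα1.le
    have hterm : ∀ x, 0 ≤ (W.graph.dist x x₀ : ℝ) ^ α * u t x * W.deg x := fun x =>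
      mul_nonneg (mul_nonneg (by positivity) (D.nonneg t ⟨ht.le, htT.le⟩ x)) (W.deg_nonneg x)
    have hbd : ∀ F : Finset V, ∑ x ∈ F, (W.graph.dist x x₀ : ℝ) ^ α * u t x * W.deg x ≤
        3 * (R : ℝ) ^ α * M := by
      intro F
      have h2 : (R : ℝ) ^ (α - 1) * (spreadConst p N * M * ρ) ≤ (R : ℝ) ^ α * M := by
        have h3 : spreadConst p N * ρ ≤ R := by
          have e : 2 * spreadConst p N / (1 / 2) * ρ = 4 * (spreadConst p N * ρ) := by ring
          rw [e] at h1 h8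
          linarith
        calc (R : ℝ) ^ (α - 1) * (spreadConst p N * M * ρ)
            = (R : ℝ) ^ (α - 1) * (spreadConst p N * ρ) * M := by ring
          _ ≤ (R : ℝ) ^ (α - 1) * R * M := by gcongr
          _ = (R : ℝ) ^ α * M := by rw [← Real.rpow_add_one hR'.ne', sub_add_cancel]
      linarith [h F]
    exact ⟨summable_of_sum_le hterm hbd, Real.tsum_le_of_sum_le hterm hbd⟩
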